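/- Let $\mathsf h$ be a complex separable Hilbert space and $\mathcal B(\mathsf h)$ the algebra of bounded operators on it. Let $\mathcal T=(\mathcal T_t)_{t\ge 0}$ be a quantum Markov semigroup on $\mathcal B(\mathsf h)$, i.e. a weakly$^*$ continuous semigroup of completely positive, identity preserving, normal (that is, $w^*$-continuous) linear maps with $\mathcal T_0=\mathrm{id}$, and assume that it is uniformly continuous: $\lim_{t\to0^+}\sup_{\|x\|\le1}\|\mathcal T_t(x)-x\|=0$. Let $$\mathcal N(\mathcal T)=\{x\in\mathcal B(\mathsf h):\ \mathcal T_t(x^*x)=\mathcal T_t(x)^*\mathcal T_t(x),\ \mathcal T_t(xx^*)=\mathcal T_t(x)\mathcal T_t(x)^*\ \ \forall t\ge0\}$$ be its decoherence-free subalgebra. Then: 1. $\mathcal N(\mathcal T)$ is a von Neumann subalgebra of $\mathcal B(\mathsf h)$, every $\mathcal T_t$ ($t\ge 0$) maps $\mathcal N(\mathcal T)$ onto itself and restricts to a $*$-automorphism of it, and $\mathcal N(\mathcal T)$ contains every von Neumann subalgebra $\mathcal M$ of $\mathcal B(\mathsf h)$ such that every $\mathcal T_t$ restricts to a $*$-automorphism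 of $\mathcal M$. 2. The semigroup extends to a norm-continuous group $(\mathcal T_t)_{t\in\mathbb R}$ of normal bounded linear maps on $\mathcal B(\mathsf h)$; each $\mathcal T_t$, $t\in\mathbb R$, maps $\mathcal N(\mathcal T)$ bijectively onto $\mathcal N(\mathcal T)$, and there is a bounded self-adjoint operator $H$ on $\mathsf h$ with $$\mathcal T_t(z)=e^{itH}\,z\,e^{-itH}\qquad (z\in\mathcal N(\mathcal T),\ t\in\mathbb R),$$ so in particular $\mathcal T_{-t}(z)=e^{-itH}\,z\,e^{itH}$ for $t>0$. Moreover, this formula holds for the operator $H$ of every Gorini–Kossakowski–Sudarshan–Lindblad representation of the semigroup, i.e. whenever $\mathcal T_t=e^{t\mathcal L}$ for all $t\ge0$ with a bounded operator $\mathcal L$ on $\mathcal B(\mathsf h)$ given by $$\mathcal L(x)=i[H,x]-\tfrac12\sum_{\ell}\bigl(L_\ell^*L_\ell x-2L_\ell^*xL_\ell+xL_\ell^*L_\ell\bigr),$$ where $H=H^*$ and $(L_\ell)$ is a sequence in $\mathcal B(\mathsf h)$ such that $\sum_\ell L_\ell^*L_\ell$ converges strongly, and the series for $\mathcal L(x)$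 converges strongly. -/

import Mathlib

open Filter Topology
open scoped NNReal CStarAlgebra

/-- The `w*`-topology (also called ultraweak or `σ`-weak topology) of `B(H)`: the initial topology
of the functionals `x ↦ ∑ₙ ⟨ξₙ, x ηₙ⟩` with `∑ₙ ‖ξₙ‖² < ∞` and `∑ₙ ‖ηₙ‖² < ∞`, that is, of the
functionals `x ↦ tr (ρ x)` with `ρ` of trace class. -/
noncomputable abbrev ultraweakTopology (H : Type*) [NormedAddCommGroup H] [InnerProductSpace ℂ H] :
    TopologicalSpace (H →L[ℂ] H) :=
  ⨅ (ξ : ℕ → H) (η : ℕ → H) (_ : Summable fun n => ‖ξ n‖ ^ 2) (_ : Summable fun n => ‖η n‖ ^ 2),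
    TopologicalSpace.induced (fun x : H →L[ℂ] H => ∑' n, inner ℂ (ξ n) (x (η n))) inferInstance

/-- A map on `B(H)` is normal if it is `w*`-continuous. -/
def IsNormalMap {H : Type*} [NormedAddCommGroup H] [InnerProductSpace ℂ H]
    (φ : (H →L[ℂ] H) → (H →L[ℂ] H)) : Prop :=
  @Continuous (H →L[ℂ] H) (H →L[ℂ] H) (ultraweakTopology H) (ultraweakTopology H) φ

/-- A quantum Markov semigroup on `B(H)`: a `w*`-continuous semigroup `(𝒯 t)`, `t ≥ 0`, of
completely positive, identity preserving, normal maps. -/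
structure QuantumMarkovSemigroup (H : Type*) [NormedAddCommGroup H] [InnerProductSpace ℂ H]
    [CompleteSpace H] where
  /-- The map at time `t`. -/
  map : ℝ≥0 → ((H →L[ℂ] H) →CP (H →L[ℂ] H))
  map_zero : ∀ x : H →L[ℂ] H, map 0 x = x
  map_add : ∀ (s t : ℝ≥0) (x : H →L[ℂ] H), map (s + t) x = map s (map t x)
  map_one : ∀ t : ℝ≥0, map t 1 = 1
  normal : ∀ t : ℝ≥0, IsNormalMap (fun x : H →L[ℂ] H => map t x)
  continuous_orbit : ∀ x : H →L[ℂ] H,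
    @Continuous ℝ≥0 (H →L[ℂ] H) inferInstance (ultraweakTopology H) (fun t => map t x)

namespace QuantumMarkovSemigroup

/-- Uniform continuity: `sup_{‖x‖ ≤ 1} ‖𝒯 t x - x‖ → 0` as `t → 0⁺`. -/
def IsUniformlyContinuous {H : Type*} [NormedAddCommGroup H] [InnerProductSpace ℂ H]
    [CompleteSpace H] (T : QuantumMarkovSemigroup H) : Prop :=
  TendstoUniformlyOn (fun (t : ℝ≥0) (x : H →L[ℂ] H) => T.map t x) (fun x => x) (𝓝[>] 0)
    (Metric.closedBall 0 1)

/-- The decoherence-free subalgebra `𝒩(𝒯)`, as a set of operators. -/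
def decoherenceFree {H : Type*} [NormedAddCommGroup H] [InnerProductSpace ℂ H]
    [CompleteSpace H] (T : QuantumMarkovSemigroup H) : Set (H →L[ℂ] H) :=
  {x | ∀ t : ℝ≥0, T.map t (star x * x) = star (T.map t x) * T.map t x ∧
    T.map t (x * star x) = T.map t x * star (T.map t x)}

/-- The bounded operator `𝓛` on `B(H)` generates the semigroup: `𝒯 t = exp (t 𝓛)`. -/
def IsGenerator {H : Type*} [NormedAddCommGroup H] [InnerProductSpace ℂ H]
    [CompleteSpace H] (T : QuantumMarkovSemigroup H)
    (𝓛 : (H →L[ℂ] H) →L[ℂ] (H →L[ℂ] H)) : Prop :=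
  ∀ (t : ℝ≥0) (x : H →L[ℂ] H), T.map t x = NormedSpace.exp (((t : ℝ) : ℂ) • 𝓛) x

/-- The operators `h` and `L 0, L 1, …` give a Gorini-Kossakowski-Sudarshan-Lindblad
representation of the semigroup: `h` is self-adjoint, `∑ₗ (L l)* (L l)` converges strongly, and the
generator is
`𝓛 x = i [h, x] - (1/2) ∑ₗ ((L l)* (L l) x - 2 (L l)* x (L l) + x (L l)* (L l))`
with strong convergence of the series. -/
def IsGKSL {H : Type*} [NormedAddCommGroup H] [InnerProductSpace ℂ H]
    [CompleteSpace H] (T : QuantumMarkovSemigroup H) (h : H →L[ℂ] H) (L : ℕ → H →L[ℂ] H) : Prop :=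
  IsSelfAdjoint h ∧
  (∀ v : H, ∃ w : H,
    Tendsto (fun n => ∑ l ∈ Finset.range n, (star (L l) * L l) v) atTop (𝓝 w)) ∧
  ∃ 𝓛 : (H →L[ℂ] H) →L[ℂ] (H →L[ℂ] H), T.IsGenerator 𝓛 ∧
    ∀ (x : H →L[ℂ] H) (v : H),
      Tendsto (fun n => (Complex.I • (h * x - x * h)) v - (1 / 2 : ℂ) • ∑ l ∈ Finset.range n,
        (star (L l) * L l * x - (2 : ℂ) • (star (L l) * x * L l) + x * (star (L l) * L l)) v)
        atTop (𝓝 (𝓛 x v))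

end QuantumMarkovSemigroup

/-- The map `φ` acts as a `*`-automorphism on the von Neumann algebra `M`: it maps `M` to itself
and its restriction to `M` is a (bijective) `*`-automorphism of `M`. -/
def ActsAsStarAutomorphism {H : Type*} [NormedAddCommGroup H] [InnerProductSpace ℂ H]
    [CompleteSpace H] (φ : (H →L[ℂ] H) → (H →L[ℂ] H)) (M : VonNeumannAlgebra H) : Prop :=
  ∃ α : M.toStarSubalgebra ≃⋆ₐ[ℂ] M.toStarSubalgebra,
    ∀ x : M.toStarSubalgebra, ((α x : M.toStarSubalgebra) : H →L[ℂ] H) = φ (x : H →L[ℂ] H)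

/-!
# The structure of the decoherence-free subalgebra

Everything rests on one consequence of complete positivity. If equality holds in the Kadison–Schwarz
inequality `φ(x)* φ(x) ≤ φ(x* x)` at `x`, then `φ(a x) = φ(a) φ(x)` for every `a`
(`CompletelyPositiveMap.map_mul_of_map_star_mul_self`). Hence `𝒩(𝒯)` consists of the `x` against
which every `𝒯 t` is multiplicative from both sides. It is a `*`-algebra, the maps of the semigroup
are `*`-homomorphisms on it, and it contains every algebra on which they are.

*It is a von Neumann algebra.* For fixed `a`, both sides of `𝒯 t (a x) = 𝒯 t (a) 𝒯 t (x)` are normal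
in `x`, and a normal functional that vanishes on a unital `*`-algebra vanishes on its bicommutant
(`normalFunctional_eq_zero_of_mem_bicommutant`). So the identity holds on `𝒩(𝒯)''`.

*The group.* A norm-continuous semigroup is `exp (t 𝓛)` with `𝓛` bounded
(`exists_eq_exp_of_continuous_semigroup`), and the group is given by the same formula for `t ∈ ℝ`.
A norm-closed algebra of maps on `B(H)` that contains the semigroup contains `𝓛`, hence the group
(`exp_smul_mem_of_forall_nonneg`). Applied to the maps that preserve `𝒩(𝒯)`, this shows that the
group acts bijectively on `𝒩(𝒯)`. Applied to the maps whose transpose preserves the predual, it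
shows that the group is normal. That the second algebra is norm closed amounts to the completeness
of the predual in the norm of the dual of `B(H)` (`isClosed_normalFunctionals`). The predual is the
range of a map `Ψ` from `ℓ¹(H × H)`, and a functional on `ℓ¹(H × H)` that vanishes on `ker Ψ` is a
bounded sesquilinear form on `H`, that is, evaluation at an operator of the same norm. By
Hahn–Banach, `Ψ` is then isometric modulo its kernel.

*The Hamiltonian.* Differentiation of the multiplicativity gives `𝓛(x a) = 𝓛(x) a + x 𝓛(a)` for
`x ∈ 𝒩(𝒯)` and all `a ∈ B(H)`. With `a = |v⟩⟨e|` for a fixed unit vector `e`, evaluated at `e`, it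
becomes `𝓛(x) = K x - x K` for `K v = 𝓛(|v⟩⟨e|) e`. The skew-adjoint part of `K` does as well, so
that `𝓛` acts on `𝒩(𝒯)` as `i [h, ·]` with `h` self-adjoint (`IsGenerator.exists_hamiltonian`). In
a GKSL representation the Leibniz rule forces `∑ [Lₗ, x]* [Lₗ, x] = 0`, so that the dissipative part
vanishes on `𝒩(𝒯)` and `𝓛 = i [h, ·]` there, with the `h` of the representation
(`IsGenerator.apply_eq_of_isGKSL`). Since the group preserves `𝒩(𝒯)`, this infinitesimal statement
integrates to the conjugation formula for all `t ∈ ℝ`.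
-/

/-! ### Unital completely positive maps and their multiplicative domain -/

section MultiplicativeDomain

variable {H : Type*} [NormedAddCommGroup H] [InnerProductSpace ℂ H] [CompleteSpace H]

/-- A nonnegative element of a C⋆-algebra is of the form `b* b`. Stated for an abstract algebra,
since the functional calculus instance is not found on matrices over `B(H)`. -/
lemma exists_eq_star_mul_self_of_nonneg {A : Type*} [NonUnitalCStarAlgebra A] [PartialOrder A]
    [StarOrderedRing A] {a : A} (h : 0 ≤ a) : ∃ b, a = star b * b :=
  CStarAlgebra.nonneg_iff_eq_star_mul_self.mp h

/-- The only consequence of complete positivity that is needed: the image under `φ` of the positive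
matrix with rows `(1, x)` and `(x*, x* x)` is again of the form `Q* Q`. -/
lemma CompletelyPositiveMap.exists_gram (φ : (H →L[ℂ] H) →CP (H →L[ℂ] H)) (x : H →L[ℂ] H) :
    ∃ P Q : Fin 2 → (H →L[ℂ] H), φ 1 = ∑ k, star (P k) * P k ∧ φ x = ∑ k, star (P k) * Q k ∧
      φ (star x) = ∑ k, star (Q k) * P k ∧ φ (star x * x) = ∑ k, star (Q k) * Q k := by
  let R : CStarMatrix (Fin 2) (Fin 2) (H →L[ℂ] H) := CStarMatrix.ofMatrix !![1, x; 0, 0]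
  have h0 : 0 ≤ (star R * R).map φ := φ.map_cstarMatrix_nonneg _ (star_mul_self_nonneg R)
  obtain ⟨S, hS⟩ := exists_eq_star_mul_self_of_nonneg h0
  have hS' : ∀ i j, φ ((star R * R) i j) = ∑ k, star (S k i) * S k j := by
    intro i j
    have := congrFun (congrFun hS i) j
    rw [CStarMatrix.map_apply, CStarMatrix.mul_apply] at this
    exact this
  have e : ∀ i j, (star R * R) i j = ∑ k, star (R k i) * R k j := fun i j => by
    rw [CStarMatrix.mul_apply]; rfl
  have r00 : R 0 0 = 1 := rfl
  have r01 : R 0 1 = x := rfl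
  have r10 : R 1 0 = 0 := rfl
  have r11 : R 1 1 = 0 := rfl
  refine ⟨fun k => S k 0, fun k => S k 1, ?_, ?_, ?_, ?_⟩
  · rw [← hS' 0 0, e]; simp [r00, r10]
  · rw [← hS' 0 1, e]; simp [r00, r10, r01, r11]
  · rw [← hS' 1 0, e]; simp [r00, r10, r01, r11]
  · rw [← hS' 1 1, e]; simp [r01, r11]

lemma CompletelyPositiveMap.apply_star (φ : (H →L[ℂ] H) →CP (H →L[ℂ] H)) (x : H →L[ℂ] H) :
    φ (star x) = star (φ x) := by
  obtain ⟨P, Q, -, h2, h3, -⟩ := φ.exists_gram x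
  rw [h2, h3, star_sum]
  simp

/-- The Kadison–Schwarz inequality. -/
lemma CompletelyPositiveMap.norm_sq_le_re_inner (φ : (H →L[ℂ] H) →CP (H →L[ℂ] H))
    (h1 : φ 1 = 1) (x : H →L[ℂ] H) (u : H) :
    ‖φ x u‖ ^ 2 ≤ (inner ℂ u (φ (star x * x) u)).re := by
  obtain ⟨P, Q, hP, h2, h3, h4⟩ := φ.exists_gram x
  have key : 0 ≤ ∑ k, ‖Q k u - P k (φ x u)‖ ^ 2 := by positivity
  have a1 : ∑ k, inner ℂ (Q k u) (Q k u) = inner ℂ u (φ (star x * x) u) := by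
    rw [h4]
    simp [ContinuousLinearMap.star_eq_adjoint, ContinuousLinearMap.adjoint_inner_right]
  have a2 : ∑ k, inner ℂ (P k (φ x u)) (Q k u) = inner ℂ (φ x u) (φ x u) := by
    conv_rhs => enter [3]; rw [h2]
    simp [ContinuousLinearMap.star_eq_adjoint, ContinuousLinearMap.adjoint_inner_right]
  have a3 : ∑ k, inner ℂ (P k (φ x u)) (P k (φ x u)) = inner ℂ (φ x u) (φ x u) := by
    have : inner ℂ (φ x u) (φ x u) = inner ℂ (φ x u) (φ 1 (φ x u)) := by rw [h1]; simp
    rw [this, hP]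
    simp [ContinuousLinearMap.star_eq_adjoint, ContinuousLinearMap.adjoint_inner_right]
  have b1 := congrArg Complex.re a1
  have b2 := congrArg Complex.re a2
  have b3 := congrArg Complex.re a3
  simp only [Complex.re_sum] at b1 b2 b3
  have e : ∀ k, ‖Q k u - P k (φ x u)‖ ^ 2 = (inner ℂ (Q k u) (Q k u)).re
      - 2 * (inner ℂ (P k (φ x u)) (Q k u)).re + (inner ℂ (P k (φ x u)) (P k (φ x u))).re := by
    intro k
    rw [@norm_sub_sq ℂ, ← inner_re_symm (𝕜 := ℂ)]
    simp [inner_self_eq_norm_sq_to_K, ← Complex.ofReal_pow]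
  simp only [e, Finset.sum_add_distrib, Finset.sum_sub_distrib, ← Finset.mul_sum] at key
  rw [b1, b2, b3] at key
  have : (inner ℂ (φ x u) (φ x u)).re = ‖φ x u‖ ^ 2 := by
    simp [inner_self_eq_norm_sq_to_K, ← Complex.ofReal_pow]
  linarith

lemma CompletelyPositiveMap.norm_apply_le (φ : (H →L[ℂ] H) →CP (H →L[ℂ] H))
    (h1 : φ 1 = 1) (x : H →L[ℂ] H) : ‖φ x‖ ≤ ‖x‖ := by
  refine ContinuousLinearMap.opNorm_le_bound _ (norm_nonneg _) fun u => ?_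
  have h := φ.norm_sq_le_re_inner h1 x u
  have hle : star x * x ≤ ((‖x‖ ^ 2 : ℝ) : ℂ) • (1 : H →L[ℂ] H) := by
    have := CStarAlgebra.star_mul_le_algebraMap_norm_sq (a := x)
    rw [Algebra.algebraMap_eq_smul_one] at this
    exact this
  have h2 := OrderHomClass.mono φ hle
  rw [map_smul, h1, ContinuousLinearMap.le_def] at h2
  have h3 := h2.re_inner_nonneg_right u
  simp only [sub_apply, smul_apply,
    one_apply_eq_self, inner_sub_right, inner_smul_right, map_sub,
    RCLike.re_eq_complex_re, Complex.re_ofReal_mul] at h3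
  have : (inner ℂ u u).re = ‖u‖ ^ 2 := by
    simp [inner_self_eq_norm_sq_to_K, ← Complex.ofReal_pow]
  rw [this] at h3
  refine abs_le_of_sq_le_sq' ?_ (by positivity) |>.2
  rw [mul_pow]
  linarith

/-- Equality in the Kadison–Schwarz inequality at `x` makes `φ` multiplicative against `x`: the
defect `φ (y* y) - φ (y)* φ (y)` is a positive sesquilinear form in `y` which vanishes at `x`, so
that by Cauchy–Schwarz it vanishes at every pair `(a*, x)`. -/
theorem CompletelyPositiveMap.map_mul_of_map_star_mul_self (φ : (H →L[ℂ] H) →CP (H →L[ℂ] H))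
    (h1 : φ 1 = 1) {x : H →L[ℂ] H} (hx : φ (star x * x) = star (φ x) * φ x) (a : H →L[ℂ] H) :
    φ (a * x) = φ a * φ x := by
  set X := φ (a * x) - φ a * φ x with hX
  have hXs : star X = φ (star x * star a) - star (φ x) * star (φ a) := by
    rw [hX, star_sub, ← φ.apply_star, star_mul, star_mul]
  suffices h : X = 0 from sub_eq_zero.mp h
  have hid : ∀ s : ℂ, φ (star (star a + s • x) * (star a + s • x))
      - star (φ (star a + s • x)) * φ (star a + s • x)
      = (φ (a * star a) - φ a * star (φ a)) + s • X + star s • star X := by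
    intro s
    rw [hXs, hX]
    simp only [star_add, star_star, star_smul, add_mul, mul_add, map_add, smul_mul_assoc,
      mul_smul_comm, map_smul, hx, φ.apply_star]
    module
  have hz : ∀ u : H, inner ℂ (X u) u = 0 := by
    intro u
    set d : ℂ := inner ℂ u (X u) with hd
    set c : ℝ := (inner ℂ u ((φ (a * star a) - φ a * star (φ a)) u)).re with hc
    have hpos : ∀ s : ℂ, 0 ≤ c + 2 * (s * d).re := by
      intro s
      have h := φ.norm_sq_le_re_inner h1 (star a + s • x) u
      have e : (inner ℂ u ((φ (star (star a + s • x) * (star a + s • x))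
          - star (φ (star a + s • x)) * φ (star a + s • x)) u)).re
          = (inner ℂ u (φ (star (star a + s • x) * (star a + s • x)) u)).re
            - ‖φ (star a + s • x) u‖ ^ 2 := by
        simp only [sub_apply, mul_apply_eq_comp, inner_sub_right,
          ContinuousLinearMap.star_eq_adjoint, ContinuousLinearMap.adjoint_inner_right,
          Complex.sub_re]
        simp [inner_self_eq_norm_sq_to_K, ← Complex.ofReal_pow]
      rw [hid s] at e
      have e2 : inner ℂ u (star X u) = star d := by
        rw [ContinuousLinearMap.star_eq_adjoint, ContinuousLinearMap.adjoint_inner_right, hd]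
        exact (inner_conj_symm _ _).symm
      simp only [add_apply, smul_apply, inner_add_right,
        inner_smul_right, e2, Complex.add_re, ← hc, ← hd] at e
      have e3 : (star s * star d).re = (s * d).re := by simp [Complex.mul_re]
      rw [e3] at e
      linarith
    have hd0 : d = 0 := by
      by_contra hne
      have hn : 0 < Complex.normSq d := Complex.normSq_pos.mpr hne
      -- a large negative multiple of `conj d` contradicts positivity unless `d = 0`
      have h := hpos (-((|c| + 1) / Complex.normSq d : ℝ) * star d)
      have e : (-(((|c| + 1) / Complex.normSq d : ℝ) : ℂ) * star d * d).re = -(|c| + 1) := by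
        have : star d * d = (Complex.normSq d : ℂ) := by
          rw [mul_comm]; exact Complex.mul_conj d
        rw [mul_assoc, this, ← Complex.ofReal_neg, ← Complex.ofReal_mul, Complex.ofReal_re]
        field_simp
      rw [e] at h
      linarith [le_abs_self c, abs_nonneg c]
    rw [← inner_conj_symm, ← hd, hd0, map_zero]
  have := (inner_map_self_eq_zero (X : H →ₗ[ℂ] H)).mp hz
  ext u
  exact congrArg (fun f : H →ₗ[ℂ] H => f u) this

end MultiplicativeDomain

/-! ### Generators of norm-continuous contraction semigroups -/

lemma exp_ofReal_zero_smul {A : Type*} [NormedRing A] [NormedAlgebra ℂ A] (a : A) :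
    NormedSpace.exp (((0 : ℝ) : ℂ) • a) = 1 := by
  rw [Complex.ofReal_zero, zero_smul, NormedSpace.exp_zero]

lemma exp_ofReal_add_smul {A : Type*} [NormedRing A] [NormedAlgebra ℂ A] [CompleteSpace A] (a : A)
    (s t : ℝ) : NormedSpace.exp (((s + t : ℝ) : ℂ) • a) =
      NormedSpace.exp ((s : ℂ) • a) * NormedSpace.exp ((t : ℂ) • a) := by
  let : NormedAlgebra ℚ A := .restrictScalars ℚ ℂ A
  rw [← NormedSpace.exp_add_of_commute, ← add_smul, Complex.ofReal_add]
  exact ((Commute.refl a).smul_left _).smul_right _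

lemma continuous_exp_ofReal_smul {A : Type*} [NormedRing A] [NormedAlgebra ℂ A] [CompleteSpace A]
    (a : A) : Continuous fun t : ℝ => NormedSpace.exp ((t : ℂ) • a) := by
  let : NormedAlgebra ℚ A := .restrictScalars ℚ ℂ A
  exact NormedSpace.exp_continuous.comp (by fun_prop)

lemma exp_smul_mul_exp_smul_neg {A : Type*} [NormedRing A] [NormedAlgebra ℂ A] [CompleteSpace A]
    (a : A) (t : ℝ) : NormedSpace.exp (t • a) * NormedSpace.exp (t • (-a)) = 1 := by
  have h := exp_ofReal_add_smul a t (-t)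
  rw [add_neg_cancel, exp_ofReal_zero_smul, Complex.coe_smul, Complex.coe_smul, neg_smul,
    ← smul_neg] at h
  exact h.symm

lemma continuous_of_contraction_semigroup {A : Type*} [NormedRing A] {F : ℝ≥0 → A} (h0 : F 0 = 1)
    (hadd : ∀ s t, F (s + t) = F s * F t) (hle : ∀ t, ‖F t‖ ≤ 1)
    (hF : Tendsto F (𝓝[>] 0) (𝓝 1)) : Continuous F := by
  have hF0 : Tendsto F (𝓝 0) (𝓝 1) := by
    have : ContinuousWithinAt F (Set.Ioi 0) 0 := by
      rw [ContinuousWithinAt, h0]; exact hF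
    have h2 := continuousWithinAt_insert_self.mpr this
    have h3 : insert (0 : ℝ≥0) (Set.Ioi 0) = Set.univ := by
      ext t; simp
    rw [h3, continuousWithinAt_univ, ContinuousAt, h0] at h2
    exact h2
  have key : ∀ s t : ℝ≥0, s ≤ t → ‖F t - F s‖ ≤ ‖F (t - s) - 1‖ := by
    intro s t hst
    have : F t - F s = F s * (F (t - s) - 1) := by
      rw [mul_sub, ← hadd, add_tsub_cancel_of_le hst, mul_one]
    rw [this]
    calc _ ≤ ‖F s‖ * ‖F (t - s) - 1‖ := norm_mul_le _ _
      _ ≤ 1 * ‖F (t - s) - 1‖ := by gcongr; exact hle s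
      _ = _ := one_mul _
  have key2 : ∀ s t : ℝ≥0, ‖F t - F s‖ ≤ ‖F ((t - s) + (s - t)) - 1‖ := by
    intro s t
    rcases le_total s t with h | h
    · rw [tsub_eq_zero_of_le h, add_zero]; exact key s t h
    · rw [tsub_eq_zero_of_le h, zero_add, norm_sub_rev]; exact key t s h
  rw [continuous_iff_continuousAt]
  intro s
  rw [ContinuousAt, tendsto_iff_norm_sub_tendsto_zero]
  refine squeeze_zero (fun _ => norm_nonneg _) (key2 s) ?_
  have hc : Continuous fun t : ℝ≥0 => (t - s) + (s - t) := by fun_prop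
  have h1 : Tendsto (fun t : ℝ≥0 => (t - s) + (s - t)) (𝓝 s) (𝓝 0) := by
    simpa using hc.tendsto s
  have h2 := ((hF0.comp h1).sub_const 1).norm
  simpa using h2

/-- A norm-continuous one-parameter semigroup in a Banach algebra is `exp (t a)`. The averages
`W t = ∫ s in t..t+δ, F s = F t * W 0` are differentiable and `W 0` is invertible for small `δ`. -/
theorem exists_eq_exp_of_continuous_semigroup {A : Type*} [NormedRing A] [NormedAlgebra ℂ A]
    [CompleteSpace A] {F : ℝ≥0 → A} (h0 : F 0 = 1)
    (hadd : ∀ s t, F (s + t) = F s * F t) (hF : Continuous F) :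
    ∃ a : A, ∀ t : ℝ≥0, F t = NormedSpace.exp (((t : ℝ) : ℂ) • a) := by
  set G : ℝ → A := fun t => F t.toNNReal with hG
  have hGc : Continuous G := hF.comp continuous_real_toNNReal
  have hG0 : G 0 = 1 := by simp [hG, h0]
  have hGadd : ∀ s t : ℝ, 0 ≤ s → 0 ≤ t → G (s + t) = G s * G t := by
    intro s t hs ht
    simp only [hG, Real.toNNReal_add hs ht, hadd]
  have hint : ∀ a b : ℝ, IntervalIntegrable G MeasureTheory.volume a b :=
    fun a b => hGc.intervalIntegrable a b
  obtain ⟨δ, hδ, hδG⟩ : ∃ δ > 0, ∀ s ∈ Set.Icc (0 : ℝ) δ, ‖G s - 1‖ ≤ 1 / 2 := by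
    obtain ⟨δ, hδ, h⟩ := Metric.continuousAt_iff.mp hGc.continuousAt (1 / 2) (by norm_num)
    refine ⟨δ / 2, by positivity, fun s hs => ?_⟩
    have := h (x := s) (by rw [Real.dist_eq, sub_zero, abs_of_nonneg hs.1]; linarith [hs.2])
    rw [hG0, dist_eq_norm] at this
    exact this.le
  set V : A := ∫ s in (0 : ℝ)..δ, G s with hV
  have hVu : IsUnit V := by
    have h1 : ‖V - (δ : ℂ) • (1 : A)‖ ≤ 1 / 2 * |δ - 0| := by
      have e : V - (δ : ℂ) • (1 : A) = ∫ s in (0 : ℝ)..δ, (G s - 1) := by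
        rw [intervalIntegral.integral_sub (hint _ _) (by simp), intervalIntegral.integral_const,
          sub_zero]
        rfl
      rw [e]
      refine intervalIntegral.norm_integral_le_of_norm_le_const fun s hs => ?_
      rw [Set.uIoc_of_le hδ.le] at hs
      exact hδG s ⟨hs.1.le, hs.2⟩
    rw [sub_zero, abs_of_pos hδ] at h1
    have hδ' : (δ : ℂ) ≠ 0 := by exact_mod_cast hδ.ne'
    have h2 : ‖(1 : A) - (δ : ℂ)⁻¹ • V‖ < 1 := by
      have e : (1 : A) - (δ : ℂ)⁻¹ • V = -((δ : ℂ)⁻¹ • (V - (δ : ℂ) • (1 : A))) := by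
        rw [smul_sub, smul_smul, inv_mul_cancel₀ hδ', one_smul, neg_sub]
      rw [e, norm_neg, norm_smul, norm_inv, Complex.norm_real, Real.norm_of_nonneg hδ.le]
      calc δ⁻¹ * _ ≤ δ⁻¹ * (1 / 2 * δ) := by gcongr
        _ < 1 := by field_simp; norm_num
    have h3 := (isUnit_one_sub_of_norm_lt_one h2)
    rw [sub_sub_cancel] at h3
    have h4 : V = algebraMap ℂ A δ * ((δ : ℂ)⁻¹ • V) := by
      rw [← Algebra.smul_def, smul_smul, mul_inv_cancel₀ hδ', one_smul]
    rw [h4]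
    exact ((isUnit_iff_ne_zero.mpr hδ').map (algebraMap ℂ A)).mul h3
  obtain ⟨u, hu⟩ := hVu
  -- the averages `W t` equal both `G t * V` and `V * G t` and satisfy `W' = a W`
  set W : ℝ → A := fun t => ∫ s in t..(t + δ), G s with hW
  have hW0 : W 0 = V := by simp [hW, hV]
  have hWG : ∀ t : ℝ, 0 ≤ t → W t = G t * V := by
    intro t ht
    have hm : G t * V = ∫ s in (0 : ℝ)..δ, G t * G s :=
      ((ContinuousLinearMap.mul ℝ A (G t)).intervalIntegral_comp_comm (hint 0 δ)).symm
    rw [hm]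
    have : W t = ∫ s in (0 : ℝ)..δ, G (t + s) := by
      rw [intervalIntegral.integral_comp_add_left (fun s => G s), add_zero]
    rw [this]
    refine intervalIntegral.integral_congr fun s hs => ?_
    rw [Set.uIcc_of_le hδ.le] at hs
    exact hGadd t s ht hs.1
  have hWG' : ∀ t : ℝ, 0 ≤ t → W t = V * G t := by
    intro t ht
    have hm : V * G t = ∫ s in (0 : ℝ)..δ, G s * G t :=
      (((ContinuousLinearMap.mul ℝ A).flip (G t)).intervalIntegral_comp_comm (hint 0 δ)).symm
    rw [hm]
    have : W t = ∫ s in (0 : ℝ)..δ, G (t + s) := by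
      rw [intervalIntegral.integral_comp_add_left (fun s => G s), add_zero]
    rw [this]
    refine intervalIntegral.integral_congr fun s hs => ?_
    rw [Set.uIcc_of_le hδ.le] at hs
    rw [add_comm, hGadd s t hs.1 ht]
  have hWd : ∀ t : ℝ, HasDerivAt W (G (t + δ) - G t) t := by
    intro t
    have hI : ∀ b : ℝ, HasDerivAt (fun r => ∫ s in (0 : ℝ)..r, G s) (G b) b := fun b =>
      intervalIntegral.integral_hasDerivAt_right (hint _ _)
        hGc.aestronglyMeasurable.stronglyMeasurableAtFilter hGc.continuousAt
    have e : W = fun r => (∫ s in (0 : ℝ)..(r + δ), G s) - ∫ s in (0 : ℝ)..r, G s := by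
      funext r
      rw [intervalIntegral.integral_interval_sub_left (hint _ _) (hint _ _)]
    rw [e]
    exact ((hI (t + δ)).comp_add_const t δ).sub (hI t)
  set a : A := (G δ - 1) * ↑u⁻¹ with ha
  have hWd' : ∀ t : ℝ, 0 ≤ t → HasDerivAt W (a * W t) t := by
    intro t ht
    have : a * W t = G (t + δ) - G t := by
      rw [hWG' t ht, ha, ← hu, mul_assoc, Units.inv_mul_cancel_left, sub_mul, one_mul, add_comm,
        hGadd δ t hδ.le ht]
    rw [this]
    exact hWd t
  have hZ : ∀ t : ℝ, 0 ≤ t →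
      HasDerivAt (fun r : ℝ => NormedSpace.exp (r • (-a)) * W r) 0 t := by
    intro t ht
    have := (hasDerivAt_exp_smul_const (𝕂 := ℝ) (-a) t).mul (hWd' t ht)
    refine this.congr_deriv ?_
    rw [mul_assoc, neg_mul, mul_neg, neg_add_cancel]
  refine ⟨a, fun t => ?_⟩
  have hconst := constant_of_has_deriv_right_zero (a := 0) (b := (t : ℝ))
    (fun r hr => (hZ r hr.1).continuousAt.continuousWithinAt)
    (fun r hr => (hZ r hr.1).hasDerivWithinAt) t ⟨t.2, le_rfl⟩
  simp only [zero_smul, NormedSpace.exp_zero, one_mul] at hconst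
  rw [hW0, hWG t t.2, ← hu, ← mul_assoc] at hconst
  replace hconst := u.isUnit.mul_right_cancel (hconst.trans (one_mul _).symm)
  have hinv := exp_smul_mul_exp_smul_neg a t
  have : G t = NormedSpace.exp ((t : ℝ) • a) := by
    rw [← one_mul (G t), ← hinv, mul_assoc, hconst, mul_one]
  rw [Complex.coe_smul, ← this]
  simp [hG]

/-! ### Absolutely convergent series and operators with closed range -/

section AbsolutelyConvexSeries

variable {ι X : Type*} [NormedAddCommGroup X] [NormedSpace ℂ X]

lemma summable_norm_lp_one (c : lp (fun _ : ι => ℂ) 1) : Summable fun i => ‖c i‖ := by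
  simpa using (lp.memℓp c).summable (by simp)

lemma norm_lp_one (c : lp (fun _ : ι => ℂ) 1) : ‖c‖ = ∑' i, ‖c i‖ := by
  simp [lp.norm_eq_tsum_rpow (p := 1) (by simp) c]

lemma norm_smul_le_of_norm_le_one {ω : ι → X} (hω : ∀ i, ‖ω i‖ ≤ 1) (c : ℂ) (i : ι) :
    ‖c • ω i‖ ≤ ‖c‖ := by
  rw [norm_smul]
  exact mul_le_of_le_one_right (norm_nonneg _) (hω i)

lemma summable_lp_one_smul [CompleteSpace X] {ω : ι → X} (hω : ∀ i, ‖ω i‖ ≤ 1)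
    (c : lp (fun _ : ι => ℂ) 1) : Summable fun i => c i • ω i :=
  Summable.of_norm_bounded (summable_norm_lp_one c) fun i => norm_smul_le_of_norm_le_one hω _ i

/-- The bounded linear map `c ↦ ∑ cᵢ ωᵢ` from `ℓ¹(ι)` to a Banach space that contains the `ωᵢ`
in its unit ball. -/
noncomputable def lpOneLift [CompleteSpace X] (ω : ι → X) (hω : ∀ i, ‖ω i‖ ≤ 1) :
    lp (fun _ : ι => ℂ) 1 →L[ℂ] X :=
  LinearMap.mkContinuous
    { toFun := fun c => ∑' i, c i • ω i
      map_add' := fun c d => by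
        rw [← (summable_lp_one_smul hω c).tsum_add (summable_lp_one_smul hω d)]
        exact tsum_congr fun i => add_smul _ _ _
      map_smul' := fun r c => by
        rw [RingHom.id_apply, ← (summable_lp_one_smul hω c).tsum_const_smul]
        exact tsum_congr fun i => mul_smul _ _ _ } 1
    fun c => by
      rw [one_mul, norm_lp_one]
      exact tsum_of_norm_bounded (summable_norm_lp_one c).hasSum
        fun i => norm_smul_le_of_norm_le_one hω _ i

lemma lpOneLift_hasSum [CompleteSpace X] {ω : ι → X} (hω : ∀ i, ‖ω i‖ ≤ 1)
    (c : lp (fun _ : ι => ℂ) 1) : HasSum (fun i => c i • ω i) (lpOneLift ω hω c) :=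
  (summable_lp_one_smul hω c).hasSum

lemma lpOneLift_single [CompleteSpace X] [DecidableEq ι] {ω : ι → X} (hω : ∀ i, ‖ω i‖ ≤ 1)
    (i : ι) (z : ℂ) : lpOneLift ω hω (lp.single 1 i z) = z • ω i := by
  refine (lpOneLift_hasSum hω _).unique ?_
  convert hasSum_ite_eq i (z • ω i) using 2 with j
  rcases eq_or_ne j i with rfl | h
  · rw [if_pos rfl, lp.single_apply_self]
  · rw [if_neg h, lp.single_apply_ne _ _ _ h, zero_smul]

/-- A bounded operator `Ψ : E → X` has closed range if every functional of norm at most one on `E`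
that vanishes on `ker Ψ` is a functional of norm at most one on `X` composed with `Ψ`: by
Hahn–Banach, the map induced on `E / ker Ψ` is then expanding. -/
theorem isClosed_range_of_dual {E : Type*} [NormedAddCommGroup E] [NormedSpace ℂ E]
    [CompleteSpace E] (Ψ : E →L[ℂ] X)
    (h : ∀ f : StrongDual ℂ E, (∀ c, ‖f c‖ ≤ ‖c‖) → (∀ c, Ψ c = 0 → f c = 0) →
      ∃ g : StrongDual ℂ X, ‖g‖ ≤ 1 ∧ ∀ c, f c = g (Ψ c)) :
    IsClosed (LinearMap.range Ψ.toLinearMap : Set X) := by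
  set K : Submodule ℂ E := LinearMap.ker Ψ.toLinearMap with hK
  have hle : K ≤ LinearMap.ker Ψ.toLinearMap := le_rfl
  set Φ : (E ⧸ K) →ₗ[ℂ] X := K.liftQ Ψ.toLinearMap hle with hΦ
  have hΦmk : ∀ c : E, Φ (K.mkQ c) = Ψ c := fun c => rfl
  have hΦle : ∀ q, ‖Φ q‖ ≤ ‖Ψ‖ * ‖q‖ := by
    intro q
    refine le_of_forall_pos_le_add fun ε hε => ?_
    obtain ⟨c, rfl, hc⟩ := Submodule.Quotient.norm_mk_lt (S := K) q
      (show (0 : ℝ) < ε / (‖Ψ‖ + 1) by positivity)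
    have h1 : Φ (Submodule.Quotient.mk c) = Ψ c := rfl
    rw [h1]
    refine (Ψ.le_opNorm c).trans ((mul_le_mul_of_nonneg_left hc.le (norm_nonneg _)).trans ?_)
    rw [mul_add]
    gcongr
    rw [mul_div_assoc', div_le_iff₀ (by positivity)]
    nlinarith [norm_nonneg Ψ]
  have hge : ∀ q, ‖q‖ ≤ ‖Φ q‖ := by
    intro q
    obtain ⟨f, hf1, hfq⟩ := exists_dual_vector'' ℂ q
    obtain ⟨c, rfl⟩ := Submodule.Quotient.mk_surjective K q
    let f' : StrongDual ℂ E := LinearMap.mkContinuous (f.toLinearMap.comp K.mkQ) 1 fun c => by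
      rw [one_mul]
      exact (f.le_of_opNorm_le hf1 _).trans
        ((one_mul _).le.trans (Submodule.Quotient.norm_mk_le K c))
    obtain ⟨g, hg1, hg⟩ := h f'
      (fun c => by
        exact (f.le_of_opNorm_le hf1 _).trans
          ((one_mul _).le.trans (Submodule.Quotient.norm_mk_le K c)))
      (fun c hc => by
        change f (Submodule.Quotient.mk c) = 0
        rw [(Submodule.Quotient.mk_eq_zero K).mpr hc, map_zero])
    have e : f (Submodule.Quotient.mk c) = g (Ψ c) := hg c
    calc ‖(Submodule.Quotient.mk c : E ⧸ K)‖ = ‖f (Submodule.Quotient.mk c)‖ := by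
          rw [hfq]; simp
      _ = ‖g (Ψ c)‖ := by rw [e]
      _ ≤ 1 * ‖Ψ c‖ := g.le_of_opNorm_le hg1 _
      _ = ‖Φ (Submodule.Quotient.mk c)‖ := one_mul _
  have hanti : AntilipschitzWith 1 Φ := by
    refine AddMonoidHomClass.antilipschitz_of_bound Φ fun q => ?_
    simpa using hge q
  have hunif : UniformContinuous Φ :=
    (AddMonoidHomClass.lipschitz_of_bound Φ ‖Ψ‖ hΦle).uniformContinuous
  have hcl := hanti.isClosed_range hunif
  convert hcl using 1
  ext y
  constructor
  · rintro ⟨c, rfl⟩; exact ⟨K.mkQ c, rfl⟩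
  · rintro ⟨q, rfl⟩
    obtain ⟨c, rfl⟩ := Submodule.Quotient.mk_surjective K q
    exact ⟨c, rfl⟩

end AbsolutelyConvexSeries

/-! ### The predual of `B(H)` -/

section Predual

variable {H : Type*} [NormedAddCommGroup H] [InnerProductSpace ℂ H]

/-- The functional `x ↦ ⟨ξ, x η⟩` on `B(H)`. -/
noncomputable def vectorFunctional (ξ η : H) : StrongDual ℂ (H →L[ℂ] H) :=
  (innerSL ℂ ξ).comp (ContinuousLinearMap.apply ℂ H η)

@[simp]
lemma vectorFunctional_apply (ξ η : H) (x : H →L[ℂ] H) :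
    vectorFunctional ξ η x = inner ℂ ξ (x η) := rfl

lemma norm_vectorFunctional_le (ξ η : H) : ‖vectorFunctional ξ η‖ ≤ ‖ξ‖ * ‖η‖ := by
  refine ContinuousLinearMap.opNorm_le_bound _ (by positivity) fun x => ?_
  calc ‖inner ℂ ξ (x η)‖ ≤ ‖ξ‖ * ‖x η‖ := norm_inner_le_norm _ _
    _ ≤ ‖ξ‖ * (‖x‖ * ‖η‖) := by gcongr; exact x.le_opNorm η
    _ = _ := by ring

/-- The normalization of a vector, `ξ / ‖ξ‖`, which is `0` for `ξ = 0`. -/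
noncomputable def normalized (ξ : H) : H := (‖ξ‖ : ℂ)⁻¹ • ξ

lemma norm_normalized_le (ξ : H) : ‖normalized ξ‖ ≤ 1 := by
  rw [normalized, norm_smul, norm_inv, Complex.norm_real, norm_norm]
  exact inv_mul_le_one

lemma norm_smul_normalized (ξ : H) : (‖ξ‖ : ℂ) • normalized ξ = ξ := by
  rcases eq_or_ne ξ 0 with rfl | h
  · simp [normalized]
  · rw [normalized, smul_smul, mul_inv_cancel₀ (by simpa using h), one_smul]

lemma norm_vectorFunctional_normalized_le (i : H × H) :
    ‖vectorFunctional (normalized i.1) (normalized i.2)‖ ≤ 1 :=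
  (norm_vectorFunctional_le _ _).trans
    (mul_le_one₀ (norm_normalized_le _) (norm_nonneg _) (norm_normalized_le _))

/-- The map `c ↦ ∑ c(ξ, η) ⟨ξ/‖ξ‖, · η/‖η‖⟩` from `ℓ¹(H × H)` to the dual of `B(H)`. Its range is
the predual of `B(H)`. -/
noncomputable def predualMap (H : Type*) [NormedAddCommGroup H] [InnerProductSpace ℂ H] :
    lp (fun _ : H × H => ℂ) 1 →L[ℂ] StrongDual ℂ (H →L[ℂ] H) :=
  lpOneLift (fun i : H × H => vectorFunctional (normalized i.1) (normalized i.2))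
    norm_vectorFunctional_normalized_le

lemma predualMap_single_norm [DecidableEq (H × H)] (ξ η : H) :
    predualMap H (lp.single 1 (ξ, η) ((‖ξ‖ * ‖η‖ : ℝ) : ℂ)) = vectorFunctional ξ η := by
  rw [predualMap, lpOneLift_single]
  ext x
  conv_rhs => rw [← norm_smul_normalized ξ, ← norm_smul_normalized η]
  simp only [smul_apply, vectorFunctional_apply, inner_smul_left, map_smul,
    inner_smul_right, smul_eq_mul, Complex.conj_ofReal, Complex.ofReal_mul]
  ring

/-- The normal functionals on `B(H)`, that is, the predual of `B(H)` as a subspace of the dual. -/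
noncomputable def normalFunctionals (H : Type*) [NormedAddCommGroup H] [InnerProductSpace ℂ H] :
    Submodule ℂ (StrongDual ℂ (H →L[ℂ] H)) :=
  LinearMap.range (predualMap H).toLinearMap

lemma vectorFunctional_mem (ξ η : H) : vectorFunctional ξ η ∈ normalFunctionals H := by
  classical
  exact ⟨_, predualMap_single_norm ξ η⟩

lemma summable_norm_mul_norm {ι H : Type*} [NormedAddCommGroup H] {ξ η : ι → H}
    (hξ : Summable fun n => ‖ξ n‖ ^ 2)
    (hη : Summable fun n => ‖η n‖ ^ 2) : Summable fun n => ‖ξ n‖ * ‖η n‖ := by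
  refine Summable.of_nonneg_of_le (fun n => by positivity) (fun n => ?_) (hξ.add hη)
  nlinarith [sq_nonneg (‖ξ n‖ - ‖η n‖), sq_nonneg ‖ξ n‖, sq_nonneg ‖η n‖]

lemma exists_mem_normalFunctionals {ξ η : ℕ → H} (hξ : Summable fun n => ‖ξ n‖ ^ 2)
    (hη : Summable fun n => ‖η n‖ ^ 2) :
    ∃ ω ∈ normalFunctionals H, ∀ x : H →L[ℂ] H, ω x = ∑' n, inner ℂ (ξ n) (x (η n)) := by
  classical
  have hs : Summable fun n =>
      lp.single (E := fun _ : H × H => ℂ) 1 (ξ n, η n) ((‖ξ n‖ * ‖η n‖ : ℝ) : ℂ) := by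
    refine Summable.of_norm ?_
    convert summable_norm_mul_norm hξ hη using 2 with n
    rw [lp.norm_single (by simp), Complex.norm_real, Real.norm_of_nonneg (by positivity)]
  refine ⟨_, ⟨∑' n, lp.single 1 (ξ n, η n) ((‖ξ n‖ * ‖η n‖ : ℝ) : ℂ), rfl⟩, fun x => ?_⟩
  have h1 := (hs.hasSum.mapL (predualMap H)).mapL (ContinuousLinearMap.apply ℂ ℂ x)
  simp only [predualMap_single_norm] at h1
  exact h1.tsum_eq.symm

/-- An absolutely convergent series `∑ cᵢ ⟨uᵢ, x vᵢ⟩` over any index set, with `uᵢ`, `vᵢ` in the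
unit ball, is a series `∑ₙ ⟨ξₙ, x ηₙ⟩` over `ℕ` with square summable `ξ` and `η`. -/
lemma exists_tsum_nat_eq {ι : Type*} {c : ι → ℂ} (hc : Summable fun i => ‖c i‖) {u v : ι → H}
    (hu : ∀ i, ‖u i‖ ≤ 1) (hv : ∀ i, ‖v i‖ ≤ 1) :
    ∃ ξ η : ℕ → H, (Summable fun n => ‖ξ n‖ ^ 2) ∧ (Summable fun n => ‖η n‖ ^ 2) ∧
      ∀ x : H →L[ℂ] H, ∑' i, c i * inner ℂ (u i) (x (v i)) = ∑' n, inner ℂ (ξ n) (x (η n)) := by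
  -- only countably many coefficients are nonzero, which allows an enumeration by `ℕ`
  set s : Set ι := Function.support fun i => ‖c i‖ with hs
  have hsc : Countable s := hc.countable_support.to_subtype
  obtain ⟨e, he⟩ := exists_injective_nat s
  have hr2 : ∀ z : ℂ, ‖((Real.sqrt ‖z‖ : ℝ) : ℂ)‖ ^ 2 = ‖z‖ := fun z => by
    rw [Complex.norm_real, Real.norm_of_nonneg (Real.sqrt_nonneg _), Real.sq_sqrt (norm_nonneg _)]
  have hne : ∀ i : s, ((Real.sqrt ‖c i‖ : ℝ) : ℂ) ≠ 0 := fun i h => i.2 (by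
    change ‖c i‖ = 0
    rw [← hr2, h]; simp)
  let f : s → H := fun i => ((Real.sqrt ‖c i‖ : ℝ) : ℂ) • u i
  let g : s → H := fun i => (c i / ((Real.sqrt ‖c i‖ : ℝ) : ℂ)) • v i
  have hcs : Summable fun i : s => ‖c i‖ := hc.subtype s
  have hfb : ∀ i, ‖f i‖ ^ 2 ≤ ‖c i‖ := fun i => by
    rw [norm_smul, mul_pow, hr2]
    exact mul_le_of_le_one_right (norm_nonneg _) (pow_le_one₀ (norm_nonneg _) (hu _))
  have hgb : ∀ i, ‖g i‖ ^ 2 ≤ ‖c i‖ := fun i => by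
    have h0 : ‖c i‖ ≠ 0 := i.2
    rw [norm_smul, mul_pow, norm_div, div_pow, hr2, sq ‖c i‖, mul_div_assoc, div_self h0, mul_one]
    exact mul_le_of_le_one_right (norm_nonneg _) (pow_le_one₀ (norm_nonneg _) (hv _))
  have hext : ∀ k : s → H, (Summable fun i => ‖k i‖ ^ 2) →
      Summable fun n => ‖Function.extend e k 0 n‖ ^ 2 := by
    intro k hk
    refine (he.summable_iff ?_).mp ?_
    · intro n hn
      rw [Function.extend_apply' _ _ _ (by simpa using hn)]
      simp
    · refine hk.congr fun i => ?_
      simp [he.extend_apply]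
  refine ⟨Function.extend e f 0, Function.extend e g 0,
    hext f (Summable.of_nonneg_of_le (fun _ => by positivity) hfb hcs),
    hext g (Summable.of_nonneg_of_le (fun _ => by positivity) hgb hcs), fun x => ?_⟩
  have h1 : ∀ n ∉ Set.range e,
      inner ℂ (Function.extend e f 0 n) (x (Function.extend e g 0 n)) = 0 := by
    intro n hn
    rw [Function.extend_apply' _ _ _ (by simpa using hn)]
    simp
  have h2 : Function.support (fun i => c i * inner ℂ (u i) (x (v i))) ⊆ s := by
    intro i hi
    simp only [Function.mem_support, ne_eq, mul_eq_zero, not_or] at hi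
    simpa [hs] using hi.1
  rw [← he.tsum_eq (Function.support_subset_iff'.mpr h1), ← tsum_subtype_eq_of_support_subset h2]
  refine tsum_congr fun i => ?_
  rw [he.extend_apply, he.extend_apply]
  simp only [f, g, inner_smul_left, map_smul, inner_smul_right, Complex.conj_ofReal]
  rw [← mul_assoc, div_mul_cancel₀ _ (hne i)]

lemma predualMap_apply_apply (c : lp (fun _ : H × H => ℂ) 1) (x : H →L[ℂ] H) :
    predualMap H c x = ∑' i : H × H, c i * inner ℂ (normalized i.1) (x (normalized i.2)) := by
  have h1 := lpOneLift_hasSum (X := StrongDual ℂ (H →L[ℂ] H))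
    (ω := fun i : H × H => vectorFunctional (normalized i.1) (normalized i.2))
    norm_vectorFunctional_normalized_le c
  have h2 := h1.mapL (ContinuousLinearMap.apply ℂ ℂ x)
  exact h2.tsum_eq.symm

lemma exists_eq_tsum_of_mem_normalFunctionals {ω : StrongDual ℂ (H →L[ℂ] H)}
    (hω : ω ∈ normalFunctionals H) : ∃ ξ η : ℕ → H, (Summable fun n => ‖ξ n‖ ^ 2) ∧
      (Summable fun n => ‖η n‖ ^ 2) ∧ ∀ x : H →L[ℂ] H, ω x = ∑' n, inner ℂ (ξ n) (x (η n)) := by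
  obtain ⟨c, hc⟩ := LinearMap.mem_range.mp hω
  obtain ⟨ξ, η, hξ, hη, h⟩ := exists_tsum_nat_eq (summable_norm_lp_one c)
    (fun i : H × H => norm_normalized_le i.1) (fun i : H × H => norm_normalized_le i.2)
  refine ⟨ξ, η, hξ, hη, fun x => ?_⟩
  rw [← h x, ← predualMap_apply_apply, ← hc]
  rfl

end Predual

/-! ### Closedness of the predual and normal maps -/

section NormalMaps

variable {H : Type*} [NormedAddCommGroup H] [InnerProductSpace ℂ H]

/-- A functional of norm at most one on `ℓ¹(H × H)` that vanishes on the kernel of `predualMap` is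
evaluation at an operator `x` in the unit ball of `B(H)`: the matrix elements `⟨ξ, x η⟩` are its
values at the preimages of the functionals `⟨ξ, · η⟩`. -/
lemma exists_operator_of_functional [CompleteSpace H]
    (f : StrongDual ℂ (lp (fun _ : H × H => ℂ) 1))
    (hf : ∀ c, ‖f c‖ ≤ ‖c‖) (hf0 : ∀ c, predualMap H c = 0 → f c = 0) :
    ∃ x : H →L[ℂ] H, ‖x‖ ≤ 1 ∧ ∀ c, f c = predualMap H c x := by
  classical
  let κ : H → H → lp (fun _ : H × H => ℂ) 1 :=
    fun ξ η => lp.single 1 (ξ, η) ((‖ξ‖ * ‖η‖ : ℝ) : ℂ)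
  have hκ : ∀ ξ η, predualMap H (κ ξ η) = vectorFunctional ξ η := predualMap_single_norm
  have hκn : ∀ ξ η, ‖f (κ ξ η)‖ ≤ ‖ξ‖ * ‖η‖ := fun ξ η => by
    refine (hf _).trans ?_
    rw [lp.norm_single (by simp), Complex.norm_real, Real.norm_of_nonneg (by positivity)]
  have hcongr : ∀ c d, predualMap H c = predualMap H d → f c = f d := fun c d h => by
    rw [← sub_eq_zero, ← map_sub]
    exact hf0 _ (by rw [map_sub, h, sub_self])
  have hv1 : ∀ ξ ξ' η : H, vectorFunctional (ξ + ξ') η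
      = vectorFunctional ξ η + vectorFunctional ξ' η := fun ξ ξ' η => by
    ext x; simp
  have hv2 : ∀ ξ η η' : H, vectorFunctional ξ (η + η')
      = vectorFunctional ξ η + vectorFunctional ξ η' := fun ξ η η' => by
    ext x; simp
  have hv3 : ∀ (z : ℂ) (ξ η : H), vectorFunctional (z • ξ) η
      = (starRingEnd ℂ) z • vectorFunctional ξ η := fun z ξ η => by
    ext x; simp [mul_comm]
  have hv4 : ∀ (z : ℂ) (ξ η : H), vectorFunctional ξ (z • η)
      = z • vectorFunctional ξ η := fun z ξ η => by
    ext x; simp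
  let B : H →L⋆[ℂ] H →L[ℂ] ℂ := LinearMap.mkContinuous₂
    (LinearMap.mk₂'ₛₗ (starRingEnd ℂ) (RingHom.id ℂ) (fun ξ η => f (κ ξ η))
      (fun ξ ξ' η => by
        rw [← map_add]; apply hcongr; rw [map_add, hκ, hκ, hκ, hv1])
      (fun z ξ η => by
        rw [← map_smul]; apply hcongr; rw [map_smul, hκ, hκ, hv3])
      (fun ξ η η' => by
        rw [← map_add]; apply hcongr; rw [map_add, hκ, hκ, hκ, hv2])
      (fun z ξ η => by
        rw [RingHom.id_apply, ← map_smul]; apply hcongr; rw [map_smul, hκ, hκ, hv4])) 1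
    (fun ξ η => by rw [one_mul]; exact hκn ξ η)
  set x : H →L[ℂ] H :=
    ContinuousLinearMap.adjoint (InnerProductSpace.continuousLinearMapOfBilin B) with hx
  have hBx : ∀ ξ η, inner ℂ ξ (x η) = f (κ ξ η) := fun ξ η => by
    rw [hx, ContinuousLinearMap.adjoint_inner_right,
      InnerProductSpace.continuousLinearMapOfBilin_apply]
    rfl
  refine ⟨x, ?_, ?_⟩
  · refine ContinuousLinearMap.opNorm_le_bound _ zero_le_one fun η => ?_
    have h1 : ‖x η‖ * ‖x η‖ ≤ ‖x η‖ * ‖η‖ := by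
      refine le_trans (le_of_eq ?_) (hκn (x η) η)
      rw [← hBx, inner_self_eq_norm_sq_to_K, norm_pow]
      simp [sq]
    rw [one_mul]
    rcases eq_or_lt_of_le (norm_nonneg (x η)) with h | h
    · rw [← h]; exact norm_nonneg _
    · exact le_of_mul_le_mul_left h1 h
  · intro c
    have key : ∀ (i : H × H) (z : ℂ), f (lp.single 1 i z) = predualMap H (lp.single 1 i z) x := by
      intro i z
      have h1 : predualMap H (lp.single 1 i z)
          = z • vectorFunctional (normalized i.1) (normalized i.2) := by
        rw [predualMap, lpOneLift_single]
      have h2 : f (lp.single 1 i z) = z • f (κ (normalized i.1) (normalized i.2)) := by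
        rw [← map_smul]
        apply hcongr
        rw [map_smul, hκ, h1]
      rw [h1, h2, ← hBx]
      rfl
    have hs := lp.hasSum_single (p := 1) (by simp) c
    have h1 := hs.mapL f
    have h2 := (hs.mapL (predualMap H)).mapL (ContinuousLinearMap.apply ℂ ℂ x)
    have he : (fun i => f (lp.single 1 i (c i))) =
        fun i => predualMap H (lp.single 1 i (c i)) x := funext fun i => key i _
    rw [he] at h1
    exact h1.unique h2

/-- The predual is norm closed in the dual of `B(H)`. -/
theorem isClosed_normalFunctionals [CompleteSpace H] :
    IsClosed (normalFunctionals H : Set (StrongDual ℂ (H →L[ℂ] H))) := by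
  refine isClosed_range_of_dual (predualMap H) fun f hf hf0 => ?_
  obtain ⟨x, hx, hfx⟩ := exists_operator_of_functional f hf hf0
  refine ⟨ContinuousLinearMap.apply ℂ ℂ x, ?_, hfx⟩
  refine ContinuousLinearMap.opNorm_le_bound _ zero_le_one fun ω => ?_
  calc ‖ω x‖ ≤ ‖ω‖ * ‖x‖ := ω.le_opNorm x
    _ ≤ 1 * ‖ω‖ := by rw [mul_comm]; gcongr

/-- The functionals that are continuous for the ultraweak topology are the normal ones. -/
theorem continuous_ultraweak_iff (ω : StrongDual ℂ (H →L[ℂ] H)) :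
    Continuous[ultraweakTopology H, inferInstance] ω ↔ ω ∈ normalFunctionals H := by
  constructor
  · intro h
    let ι := {p : (ℕ → H) × (ℕ → H) //
      (Summable fun n => ‖p.1 n‖ ^ 2) ∧ (Summable fun n => ‖p.2 n‖ ^ 2)}
    choose F hF hFx using fun p : ι => exists_mem_normalFunctionals p.2.1 p.2.2
    have htop : ultraweakTopology H
        = ⨅ p : ι, TopologicalSpace.induced (F p).toLinearMap inferInstance := by
      refine le_antisymm (le_iInf fun p => ?_) ?_
      · refine (iInf_le _ p.1.1).trans ((iInf_le _ p.1.2).trans ((iInf_le _ p.2.1).trans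
          ((iInf_le _ p.2.2).trans (le_of_eq ?_))))
        congr 1
        funext x
        exact (hFx p x).symm
      · refine le_iInf fun ξ => le_iInf fun η => le_iInf fun hξ => le_iInf fun hη => ?_
        refine (iInf_le _ (⟨(ξ, η), hξ, hη⟩ : ι)).trans (le_of_eq ?_)
        congr 1
        funext x
        exact hFx ⟨(ξ, η), hξ, hη⟩ x
    have h2 := (LinearMap.mem_span_iff_continuous (f := fun p : ι => (F p).toLinearMap)
      ω.toLinearMap).mpr (by rw [← htop]; exact h)
    have h3 : Submodule.span ℂ (Set.range fun p : ι => (F p).toLinearMap)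
        ≤ (normalFunctionals H).map (ContinuousLinearMap.coeLM ℂ) := by
      rw [Submodule.span_le]
      rintro _ ⟨p, rfl⟩
      exact ⟨F p, hF p, rfl⟩
    obtain ⟨ω', hω', he⟩ := h3 h2
    rwa [← ContinuousLinearMap.coe_injective he]
  · intro h
    obtain ⟨ξ, η, hξ, hη, hω⟩ := exists_eq_tsum_of_mem_normalFunctionals h
    have : (ω : (H →L[ℂ] H) → ℂ) = fun x => ∑' n, inner ℂ (ξ n) (x (η n)) := funext hω
    rw [this, continuous_iff_le_induced]
    exact (iInf_le _ ξ).trans ((iInf_le _ η).trans ((iInf_le _ hξ).trans (iInf_le _ hη)))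

/-- A bounded linear map is normal if and only if its transpose preserves the predual. -/
theorem isNormalMap_iff (φ : (H →L[ℂ] H) →L[ℂ] (H →L[ℂ] H)) :
    IsNormalMap (fun x => φ x) ↔ ∀ ω ∈ normalFunctionals H, ω.comp φ ∈ normalFunctionals H := by
  constructor
  · intro h ω hω
    rw [← continuous_ultraweak_iff] at hω ⊢
    let : TopologicalSpace (H →L[ℂ] H) := ultraweakTopology H
    exact Continuous.comp (g := fun x => ω x) hω h
  · intro h
    refine continuous_iInf_rng.mpr fun ξ => continuous_iInf_rng.mpr fun η =>
      continuous_iInf_rng.mpr fun hξ => continuous_iInf_rng.mpr fun hη => ?_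
    rw [continuous_induced_rng]
    obtain ⟨ω, hω, hωx⟩ := exists_mem_normalFunctionals hξ hη
    have := (continuous_ultraweak_iff _).mpr (h ω hω)
    convert this using 1
    funext x
    exact (hωx (φ x)).symm

lemma normalFunctional_comp_mul_left_mem [CompleteSpace H] {ω : StrongDual ℂ (H →L[ℂ] H)}
    (hω : ω ∈ normalFunctionals H) (a : H →L[ℂ] H) :
    ω.comp (ContinuousLinearMap.mul ℂ (H →L[ℂ] H) a) ∈ normalFunctionals H := by
  obtain ⟨ξ, η, hξ, hη, h⟩ := exists_eq_tsum_of_mem_normalFunctionals hω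
  have hξ' : Summable fun n => ‖star a (ξ n)‖ ^ 2 := by
    refine Summable.of_nonneg_of_le (fun n => by positivity) (fun n => ?_)
      (hξ.mul_left (‖star a‖ ^ 2))
    rw [← mul_pow]
    gcongr
    exact (star a).le_opNorm _
  obtain ⟨ω', hω', h'⟩ := exists_mem_normalFunctionals hξ' hη
  have : ω.comp (ContinuousLinearMap.mul ℂ (H →L[ℂ] H) a) = ω' := by
    ext x
    rw [ContinuousLinearMap.comp_apply, h, h']
    refine tsum_congr fun n => ?_
    rw [ContinuousLinearMap.star_eq_adjoint, ContinuousLinearMap.adjoint_inner_left]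
    rfl
  rwa [this]

/-- The bounded linear maps on `B(H)` whose transpose preserves the predual. -/
noncomputable def normalMaps (H : Type*) [NormedAddCommGroup H] [InnerProductSpace ℂ H] :
    Subalgebra ℂ ((H →L[ℂ] H) →L[ℂ] (H →L[ℂ] H)) where
  carrier := {φ | ∀ ω ∈ normalFunctionals H, ω.comp φ ∈ normalFunctionals H}
  mul_mem' := fun {φ ψ} hφ hψ ω hω => hψ _ (hφ ω hω)
  add_mem' := fun {φ ψ} hφ hψ ω hω => by
    rw [ContinuousLinearMap.comp_add]
    exact add_mem (hφ ω hω) (hψ ω hω)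
  algebraMap_mem' := fun r ω hω => by
    rw [Algebra.algebraMap_eq_smul_one]
    have : ω.comp (r • (1 : (H →L[ℂ] H) →L[ℂ] (H →L[ℂ] H))) = r • ω := by
      ext x; simp
    rw [this]
    exact Submodule.smul_mem _ _ hω

lemma isClosed_normalMaps [CompleteSpace H] :
    IsClosed (normalMaps H : Set ((H →L[ℂ] H) →L[ℂ] (H →L[ℂ] H))) := by
  have : (normalMaps H : Set ((H →L[ℂ] H) →L[ℂ] (H →L[ℂ] H)))
      = ⋂ ω ∈ normalFunctionals H, (fun φ : (H →L[ℂ] H) →L[ℂ] (H →L[ℂ] H) => ω.comp φ) ⁻¹'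
        (normalFunctionals H : Set (StrongDual ℂ (H →L[ℂ] H))) := by
    ext φ
    simp only [Set.mem_iInter]
    rfl
  rw [this]
  refine isClosed_biInter fun ω _ => isClosed_normalFunctionals.preimage ?_
  exact (ContinuousLinearMap.compL ℂ _ _ _ ω).continuous

/-- A closed subalgebra that contains a semigroup `exp (t a)`, `t ≥ 0`, contains the generator
`a`, hence the whole group. -/
lemma exp_smul_mem_of_forall_nonneg {A : Type*} [NormedRing A] [NormedAlgebra ℂ A]
    [CompleteSpace A] {S : Subalgebra ℂ A} (hS : IsClosed (S : Set A)) {a : A}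
    (ha : ∀ t : ℝ, 0 ≤ t → NormedSpace.exp ((t : ℂ) • a) ∈ S) (t : ℝ) :
    NormedSpace.exp ((t : ℂ) • a) ∈ S := by
  have haS : a ∈ S := by
    have h1 := (hasDerivAt_exp_smul_const (𝕂 := ℝ) a 0).tendsto_slope_zero_right
    simp only [zero_smul, NormedSpace.exp_zero, one_mul, zero_add] at h1
    refine hS.mem_of_tendsto h1 ?_
    filter_upwards [self_mem_nhdsWithin] with s hs
    rw [← Complex.coe_smul s⁻¹]
    refine S.smul_mem (sub_mem ?_ (one_mem S)) _
    rw [← Complex.coe_smul]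
    exact ha s (le_of_lt hs)
  have h2 := NormedSpace.exp_series_hasSum_exp' (𝕂 := ℂ) ((t : ℂ) • a)
  exact hS.mem_of_tendsto h2 (Eventually.of_forall fun s =>
    sum_mem fun n _ => S.smul_mem (pow_mem (S.smul_mem haS _) _) _)

end NormalMaps

/-! ### Normal functionals on a bicommutant -/

section Bicommutant

variable {H : Type*} [NormedAddCommGroup H] [InnerProductSpace ℂ H]

lemma memℓp_two_map (x : H →L[ℂ] H) (f : lp (fun _ : ℕ => H) 2) : Memℓp (fun i => x (f i)) 2 := by
  refine memℓp_gen ?_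
  have hs : Summable fun i => ‖x‖ ^ 2 * ‖f i‖ ^ 2 := by
    simpa using ((lp.memℓp f).summable (by simp)).mul_left (‖x‖ ^ 2)
  refine Summable.of_nonneg_of_le (fun i => by positivity) (fun i => ?_) hs
  simp only [ENNReal.toReal_ofNat, Real.rpow_ofNat]
  rw [← mul_pow]
  gcongr
  exact x.le_opNorm _

/-- The operator `x ⊗ 1` on `H ⊗ ℓ² = ℓ²(ℕ, H)`, which acts by `x` on every coordinate. -/
noncomputable def amplification (x : H →L[ℂ] H) :
    lp (fun _ : ℕ => H) 2 →L[ℂ] lp (fun _ : ℕ => H) 2 :=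
  LinearMap.mkContinuous
    { toFun := fun f => ⟨fun i => x (f i), memℓp_two_map x f⟩
      map_add' := fun f g => by ext i; exact map_add x _ _
      map_smul' := fun r f => by ext i; exact map_smul x _ _ } ‖x‖ fun f => by
    refine lp.norm_le_of_tsum_le (by simp) (by positivity) ?_
    have h2 : ‖f‖ ^ 2 = ∑' i, ‖f i‖ ^ 2 := by
      simpa using lp.norm_rpow_eq_tsum (p := 2) (by simp) f
    have hs : Summable fun i => ‖x‖ ^ 2 * ‖f i‖ ^ 2 := by
      simpa using ((lp.memℓp f).summable (by simp)).mul_left (‖x‖ ^ 2)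
    have hs' : Summable fun i => ‖x (f i)‖ ^ 2 := by
      simpa using (memℓp_two_map x f).summable (by simp)
    simp only [ENNReal.toReal_ofNat, Real.rpow_ofNat]
    rw [mul_pow, h2, ← tsum_mul_left]
    refine hs'.tsum_le_tsum (fun i => ?_) hs
    rw [← mul_pow]
    gcongr
    exact x.le_opNorm _

@[simp]
lemma amplification_apply (x : H →L[ℂ] H) (f : lp (fun _ : ℕ => H) 2) (i : ℕ) :
    amplification x f i = x (f i) := rfl

lemma amplification_single (x : H →L[ℂ] H) (i : ℕ) (v : H) :
    amplification x (lp.single 2 i v) = lp.single 2 i (x v) := by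
  ext j
  rw [amplification_apply]
  rcases eq_or_ne j i with rfl | h
  · rw [lp.single_apply_self, lp.single_apply_self]
  · rw [lp.single_apply_ne _ _ _ h, lp.single_apply_ne _ _ _ h, map_zero]

lemma inner_amplification [CompleteSpace H] (x : H →L[ℂ] H) (f g : lp (fun _ : ℕ => H) 2) :
    inner ℂ f (amplification x g) = inner ℂ (amplification (star x) f) g := by
  rw [lp.inner_eq_tsum, lp.inner_eq_tsum]
  refine tsum_congr fun i => ?_
  rw [amplification_apply, amplification_apply, ContinuousLinearMap.star_eq_adjoint,
    ContinuousLinearMap.adjoint_inner_left]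

/-- The heart of the bicommutant theorem: a normal functional that vanishes on a unital
`*`-algebra `N` vanishes on `N''`. The functional is `x ↦ ⟨ξ, (x ⊗ 1) η⟩`, and the projection onto
the closure of `(N ⊗ 1) η` has its matrix entries in `N'`, so that it commutes with `x ⊗ 1`. -/
theorem normalFunctional_eq_zero_of_mem_bicommutant [CompleteSpace H]
    (N : StarSubalgebra ℂ (H →L[ℂ] H)) {ω : StrongDual ℂ (H →L[ℂ] H)}
    (hω : ω ∈ normalFunctionals H) (h0 : ∀ a ∈ N, ω a = 0) {x : H →L[ℂ] H}
    (hx : x ∈ Set.centralizer (Set.centralizer (N : Set (H →L[ℂ] H)))) : ω x = 0 := by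
  obtain ⟨ξ', η', hξ, hη, hωx⟩ := exists_eq_tsum_of_mem_normalFunctionals hω
  let ξ : lp (fun _ : ℕ => H) 2 := ⟨ξ', memℓp_gen (by simpa using hξ)⟩
  let η : lp (fun _ : ℕ => H) 2 := ⟨η', memℓp_gen (by simpa using hη)⟩
  have hω' : ∀ y, ω y = inner ℂ ξ (amplification y η) := fun y => by
    rw [hωx, lp.inner_eq_tsum]; rfl
  let S₀ : Submodule ℂ (lp (fun _ : ℕ => H) 2) :=
    { carrier := {k | ∃ a ∈ N, k = amplification a η}
      add_mem' := by
        rintro _ _ ⟨a, ha, rfl⟩ ⟨b, hb, rfl⟩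
        exact ⟨a + b, add_mem ha hb, by ext i; rfl⟩
      zero_mem' := ⟨0, zero_mem N, by ext i; rfl⟩
      smul_mem' := by
        rintro r _ ⟨a, ha, rfl⟩
        exact ⟨r • a, SMulMemClass.smul_mem r ha, by ext i; rfl⟩ }
  set S := S₀.topologicalClosure with hS
  have hSc : IsClosed (S : Set (lp (fun _ : ℕ => H) 2)) := S₀.isClosed_topologicalClosure
  have : CompleteSpace S := hSc.completeSpace_coe
  have hηS : η ∈ S := S₀.le_topologicalClosure ⟨1, one_mem N, by ext i; rfl⟩
  have hinv : ∀ a ∈ N, ∀ k ∈ S, amplification a k ∈ S := by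
    intro a ha k hk
    have hm : Set.MapsTo (amplification a) (S₀ : Set (lp (fun _ : ℕ => H) 2)) S₀ := by
      rintro _ ⟨b, hb, rfl⟩
      exact ⟨a * b, mul_mem ha hb, by ext i; rfl⟩
    exact hm.closure (amplification a).continuous hk
  have hinv' : ∀ a ∈ N, ∀ k ∈ Sᗮ, amplification a k ∈ Sᗮ := by
    intro a ha k hk
    rw [Submodule.mem_orthogonal] at hk ⊢
    intro s hs
    rw [inner_amplification]
    exact hk _ (hinv _ (star_mem ha) s hs)
  have hcomm : ∀ a ∈ N, ∀ k,
      S.starProjection (amplification a k) = amplification a (S.starProjection k) := by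
    intro a ha k
    refine (Submodule.eq_starProjection_of_mem_orthogonal
      (hinv a ha _ (S.starProjection_apply_mem k)) ?_)
    rw [← map_sub]
    exact hinv' a ha _ (S.sub_starProjection_mem_orthogonal k)
  have hentry : ∀ i j : ℕ, (lp.evalCLM ℂ (fun _ : ℕ => H) 2 i ∘L S.starProjection ∘L
      lp.singleContinuousLinearMap ℂ (fun _ : ℕ => H) 2 j) ∈
        Set.centralizer (N : Set (H →L[ℂ] H)) := by
    intro i j a ha
    ext v
    change a (S.starProjection (lp.single 2 j v) i) = S.starProjection (lp.single 2 j (a v)) i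
    rw [← amplification_single, hcomm a ha, amplification_apply]
  -- the projection commutes with `x ⊗ 1`, since its matrix entries commute with `x`
  have hcommx : amplification x ∘L S.starProjection = S.starProjection ∘L amplification x := by
    refine lp.ext_continuousLinearMap (by simp) fun j => ?_
    ext v i
    have h := congrArg (fun f : H →L[ℂ] H => f v) (hx _ (hentry i j))
    change S.starProjection (lp.single 2 j (x v)) i = x (S.starProjection (lp.single 2 j v) i) at h
    change x (S.starProjection (lp.single 2 j v) i) =
      S.starProjection (amplification x (lp.single 2 j v)) i
    rw [amplification_single, h]
  have hxS : amplification x η ∈ S := by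
    have h := congrArg (fun f => f η) hcommx
    simp only [ContinuousLinearMap.comp_apply] at h
    rw [Submodule.starProjection_eq_self_iff.mpr hηS] at h
    exact Submodule.starProjection_eq_self_iff.mp h.symm
  have hξS : S ≤ LinearMap.ker (innerSL ℂ ξ).toLinearMap := by
    refine S₀.topologicalClosure_minimal ?_ (innerSL ℂ ξ).isClosed_ker
    rintro _ ⟨a, ha, rfl⟩
    exact (hω' a).symm.trans (h0 a ha)
  rw [hω']
  exact hξS hxS

end Bicommutant

/-! ### The decoherence-free subalgebra -/

namespace QuantumMarkovSemigroup

variable {H : Type*} [NormedAddCommGroup H] [InnerProductSpace ℂ H] [CompleteSpace H]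
  (T : QuantumMarkovSemigroup H)

lemma star_mem_decoherenceFree {x : H →L[ℂ] H} (hx : x ∈ T.decoherenceFree) :
    star x ∈ T.decoherenceFree := fun t => by
  rw [(T.map t).apply_star, star_star, star_star]
  exact ⟨(hx t).2, (hx t).1⟩

variable {T} in
lemma map_mul_of_mem_right {x : H →L[ℂ] H} (hx : x ∈ T.decoherenceFree) (t : ℝ≥0)
    (a : H →L[ℂ] H) : T.map t (a * x) = T.map t a * T.map t x :=
  (T.map t).map_mul_of_map_star_mul_self (T.map_one t) (hx t).1 a

variable {T} in
lemma map_mul_of_mem_left {x : H →L[ℂ] H} (hx : x ∈ T.decoherenceFree) (t : ℝ≥0)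
    (a : H →L[ℂ] H) : T.map t (x * a) = T.map t x * T.map t a := by
  have h := map_mul_of_mem_right (T.star_mem_decoherenceFree hx) t (star a)
  rw [← star_mul, (T.map t).apply_star, (T.map t).apply_star, (T.map t).apply_star,
    ← star_mul] at h
  exact star_injective h

lemma mem_decoherenceFree_of_forall_map_mul {x : H →L[ℂ] H}
    (h1 : ∀ t a, T.map t (a * x) = T.map t a * T.map t x)
    (h2 : ∀ t a, T.map t (x * a) = T.map t x * T.map t a) : x ∈ T.decoherenceFree := fun t => by
  rw [h1, h2, (T.map t).apply_star]
  exact ⟨rfl, rfl⟩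

/-- The decoherence-free subalgebra as a unital `*`-subalgebra of `B(H)`: it is the intersection of
the multiplicative domains of the maps of the semigroup. -/
noncomputable def decoherenceFreeSubalgebra : StarSubalgebra ℂ (H →L[ℂ] H) where
  carrier := T.decoherenceFree
  mul_mem' := fun {x y} hx hy => by
    refine T.mem_decoherenceFree_of_forall_map_mul (fun t a => ?_) (fun t a => ?_)
    · rw [← mul_assoc, map_mul_of_mem_right hy, map_mul_of_mem_right hx, map_mul_of_mem_right hy,
        mul_assoc]
    · rw [mul_assoc, map_mul_of_mem_left hx, map_mul_of_mem_left hy, map_mul_of_mem_left hx,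
        mul_assoc]
  add_mem' := fun {x y} hx hy => by
    refine T.mem_decoherenceFree_of_forall_map_mul (fun t a => ?_) (fun t a => ?_)
    · rw [mul_add, _root_.map_add, map_mul_of_mem_right hx, map_mul_of_mem_right hy,
        _root_.map_add, mul_add]
    · rw [add_mul, _root_.map_add, map_mul_of_mem_left hx, map_mul_of_mem_left hy, _root_.map_add,
        add_mul]
  algebraMap_mem' := fun r => by
    refine T.mem_decoherenceFree_of_forall_map_mul (fun t a => ?_) (fun t a => ?_)
    · simp [Algebra.algebraMap_eq_smul_one, T.map_one]
    · simp [Algebra.algebraMap_eq_smul_one, T.map_one]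
  star_mem' := fun hx => T.star_mem_decoherenceFree hx

lemma map_mem_decoherenceFree (t : ℝ≥0) {x : H →L[ℂ] H} (hx : x ∈ T.decoherenceFree) :
    T.map t x ∈ T.decoherenceFree := fun s => by
  rw [← (hx t).1, ← (hx t).2, ← T.map_add, ← T.map_add, ← T.map_add]
  exact hx (s + t)

/-- The maps of the semigroup as bounded operators on `B(H)`. -/
noncomputable def mapL (t : ℝ≥0) : (H →L[ℂ] H) →L[ℂ] (H →L[ℂ] H) :=
  LinearMap.mkContinuous (T.map t).toLinearMap 1 fun x => by
    rw [one_mul]; exact (T.map t).norm_apply_le (T.map_one t) x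

@[simp]
lemma mapL_apply (t : ℝ≥0) (x : H →L[ℂ] H) : T.mapL t x = T.map t x := rfl

lemma norm_mapL_le (t : ℝ≥0) : ‖T.mapL t‖ ≤ 1 := LinearMap.mkContinuous_norm_le _ zero_le_one _

/-- The identity `𝒯 t (a x) = 𝒯 t (a) 𝒯 t (x)` passes from `𝒩(𝒯)` to its bicommutant, since both sides
are normal in `x`. -/
lemma map_mul_of_mem_bicommutant {x : H →L[ℂ] H}
    (hx : x ∈ Set.centralizer (Set.centralizer T.decoherenceFree)) (t : ℝ≥0) (a : H →L[ℂ] H) :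
    T.map t (a * x) = T.map t a * T.map t x := by
  have hn := (isNormalMap_iff (T.mapL t)).mp (T.normal t)
  ext v
  refine ext_inner_left ℂ fun u => ?_
  set ω₁ : StrongDual ℂ (H →L[ℂ] H) := ((vectorFunctional u v).comp (T.mapL t)).comp
    (ContinuousLinearMap.mul ℂ (H →L[ℂ] H) a) with hω₁
  set ω₂ : StrongDual ℂ (H →L[ℂ] H) :=
    (vectorFunctional (star (T.map t a) u) v).comp (T.mapL t) with hω₂
  have h1 : ∀ y, ω₁ y = inner ℂ u (T.map t (a * y) v) := fun y => rfl
  have h2 : ∀ y, ω₂ y = inner ℂ u ((T.map t a * T.map t y) v) := fun y => by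
    change inner ℂ (star (T.map t a) u) (T.map t y v) = _
    rw [ContinuousLinearMap.star_eq_adjoint, ContinuousLinearMap.adjoint_inner_left]
    rfl
  have hmem : ω₁ - ω₂ ∈ normalFunctionals H :=
    sub_mem (normalFunctional_comp_mul_left_mem (hn _ (vectorFunctional_mem _ _)) a)
      (hn _ (vectorFunctional_mem _ _))
  have h0 := normalFunctional_eq_zero_of_mem_bicommutant T.decoherenceFreeSubalgebra hmem
    (fun y hy => by
      rw [sub_apply, h1, h2, map_mul_of_mem_right hy, sub_self]) hx
  rw [sub_apply, h1, h2, sub_eq_zero] at h0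
  exact h0

/-- The decoherence-free subalgebra as a von Neumann algebra. -/
noncomputable def decoherenceFreeVonNeumannAlgebra : VonNeumannAlgebra H where
  toStarSubalgebra := T.decoherenceFreeSubalgebra
  centralizer_centralizer' := by
    refine Set.Subset.antisymm (fun x hx => ?_) Set.subset_centralizer_centralizer
    have hs : ∀ y ∈ Set.centralizer T.decoherenceFree,
        star y ∈ Set.centralizer T.decoherenceFree := fun y hy =>
      Set.star_mem_centralizer' (fun a ha => T.star_mem_decoherenceFree ha) hy
    have hx' : star x ∈ Set.centralizer (Set.centralizer T.decoherenceFree) :=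
      Set.star_mem_centralizer' hs hx
    intro t
    have h1 := T.map_mul_of_mem_bicommutant hx t (star x)
    have h2 := T.map_mul_of_mem_bicommutant hx' t x
    rw [(T.map t).apply_star] at h1 h2
    exact ⟨h1, h2⟩

@[simp]
lemma coe_decoherenceFreeVonNeumannAlgebra :
    (T.decoherenceFreeVonNeumannAlgebra : Set (H →L[ℂ] H)) = T.decoherenceFree := rfl

lemma isClosed_decoherenceFree : IsClosed T.decoherenceFree := by
  rw [← T.coe_decoherenceFreeVonNeumannAlgebra, ← VonNeumannAlgebra.centralizer_centralizer]
  exact Set.isClosed_centralizer _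

/-- The bounded operators on `B(H)` that map `𝒩(𝒯)` to itself. -/
noncomputable def preservingMaps : Subalgebra ℂ ((H →L[ℂ] H) →L[ℂ] (H →L[ℂ] H)) where
  carrier := {φ | ∀ z ∈ T.decoherenceFree, φ z ∈ T.decoherenceFree}
  mul_mem' := fun {φ ψ} hφ hψ z hz => hφ _ (hψ z hz)
  add_mem' := fun {φ ψ} hφ hψ z hz =>
    T.decoherenceFreeSubalgebra.add_mem (hφ z hz) (hψ z hz)
  algebraMap_mem' := fun r z hz => by
    rw [Algebra.algebraMap_eq_smul_one]
    exact T.decoherenceFreeSubalgebra.smul_mem hz r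

lemma isClosed_preservingMaps :
    IsClosed (T.preservingMaps : Set ((H →L[ℂ] H) →L[ℂ] (H →L[ℂ] H))) := by
  have : (T.preservingMaps : Set ((H →L[ℂ] H) →L[ℂ] (H →L[ℂ] H)))
      = ⋂ z ∈ T.decoherenceFree, (fun φ : (H →L[ℂ] H) →L[ℂ] (H →L[ℂ] H) => φ z) ⁻¹'
        T.decoherenceFree := by
    ext φ
    simp only [Set.mem_iInter]
    rfl
  rw [this]
  exact isClosed_biInter fun z _ => T.isClosed_decoherenceFree.preimage
    (ContinuousLinearMap.apply ℂ _ z).continuous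

/-! ### The generator and the group it generates -/

lemma exists_isGenerator (hT : T.IsUniformlyContinuous) :
    ∃ 𝓛 : (H →L[ℂ] H) →L[ℂ] (H →L[ℂ] H), T.IsGenerator 𝓛 := by
  have h0 : T.mapL 0 = 1 := by
    refine ContinuousLinearMap.ext fun x => ?_
    rw [mapL_apply, T.map_zero]; rfl
  have hadd : ∀ s t, T.mapL (s + t) = T.mapL s * T.mapL t := fun s t =>
    ContinuousLinearMap.ext fun x => T.map_add s t x
  have hlim : Tendsto T.mapL (𝓝[>] 0) (𝓝 1) := by
    rw [Metric.tendsto_nhds]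
    intro ε hε
    filter_upwards [Metric.tendstoUniformlyOn_iff.mp hT (ε / 2) (by positivity)] with t ht
    rw [dist_eq_norm]
    refine lt_of_le_of_lt (ContinuousLinearMap.opNorm_le_of_unit_norm (by positivity)
      fun x hx => ?_) (half_lt_self hε)
    have := ht x (by simp [hx])
    rw [dist_comm, dist_eq_norm] at this
    exact this.le
  obtain ⟨𝓛, h⟩ := exists_eq_exp_of_continuous_semigroup h0 hadd
    (continuous_of_contraction_semigroup h0 hadd T.norm_mapL_le hlim)
  exact ⟨𝓛, fun t x => by rw [← h t]; rfl⟩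

end QuantumMarkovSemigroup

/-! ### The Hamiltonian on the decoherence-free subalgebra -/

namespace QuantumMarkovSemigroup

variable {H : Type*} [NormedAddCommGroup H] [InnerProductSpace ℂ H] [CompleteSpace H]
  {T : QuantumMarkovSemigroup H} {𝓛 : (H →L[ℂ] H) →L[ℂ] (H →L[ℂ] H)}

lemma exp_zero_generator_apply (𝓛 : (H →L[ℂ] H) →L[ℂ] (H →L[ℂ] H)) (x : H →L[ℂ] H) :
    NormedSpace.exp (((0 : ℝ) : ℂ) • 𝓛) x = x :=
  congrArg (fun φ : (H →L[ℂ] H) →L[ℂ] (H →L[ℂ] H) => φ x) (exp_ofReal_zero_smul 𝓛)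

lemma hasDerivAt_exp_generator (𝓛 : (H →L[ℂ] H) →L[ℂ] (H →L[ℂ] H)) (x : H →L[ℂ] H) (t : ℝ) :
    HasDerivAt (fun t : ℝ => NormedSpace.exp ((t : ℂ) • 𝓛) x)
      (𝓛 (NormedSpace.exp ((t : ℂ) • 𝓛) x)) t := by
  have h := hasDerivAt_exp_smul_const' (𝕂 := ℝ) 𝓛 t
  have h2 := ((ContinuousLinearMap.apply ℂ _ x).restrictScalars ℝ).hasFDerivAt.comp_hasDerivAt t h
  simp only [← Complex.coe_smul] at h2
  exact h2

lemma IsGenerator.hasDerivWithinAt (h : T.IsGenerator 𝓛) (x : H →L[ℂ] H) :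
    HasDerivWithinAt (fun t : ℝ => T.map t.toNNReal x) (𝓛 x) (Set.Ici 0) 0 := by
  have h1 := (hasDerivAt_exp_generator 𝓛 x 0).hasDerivWithinAt (s := Set.Ici 0)
  rw [exp_zero_generator_apply] at h1
  refine h1.congr (fun t ht => ?_) ?_
  · rw [h, Real.coe_toNNReal t ht]
  · rw [h, Real.coe_toNNReal 0 le_rfl]

lemma IsGenerator.unique {𝓛' : (H →L[ℂ] H) →L[ℂ] (H →L[ℂ] H)} (h : T.IsGenerator 𝓛)
    (h' : T.IsGenerator 𝓛') : 𝓛 = 𝓛' :=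
  ContinuousLinearMap.ext fun x =>
    (uniqueDiffWithinAt_Ici (0 : ℝ)).eq_deriv _ (h.hasDerivWithinAt x) (h'.hasDerivWithinAt x)

lemma IsGenerator.apply_star (h : T.IsGenerator 𝓛) (x : H →L[ℂ] H) :
    𝓛 (star x) = star (𝓛 x) := by
  have h1 := (h.hasDerivWithinAt x).star
  refine (uniqueDiffWithinAt_Ici (0 : ℝ)).eq_deriv _ (h.hasDerivWithinAt (star x)) ?_
  simpa only [← (T.map _).apply_star] using h1

/-- On the decoherence-free subalgebra the generator satisfies the Leibniz rule against every
operator, because the maps of the semigroup are multiplicative there. -/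
lemma IsGenerator.apply_mul (h : T.IsGenerator 𝓛) {x : H →L[ℂ] H} (hx : x ∈ T.decoherenceFree)
    (a : H →L[ℂ] H) : 𝓛 (x * a) = 𝓛 x * a + x * 𝓛 a := by
  have h1 := (h.hasDerivWithinAt x).mul (h.hasDerivWithinAt a)
  simp only [Real.toNNReal_zero, T.map_zero] at h1
  refine (uniqueDiffWithinAt_Ici (0 : ℝ)).eq_deriv _ (h.hasDerivWithinAt (x * a)) ?_
  refine h1.congr (fun t _ => ?_) ?_
  · exact map_mul_of_mem_left hx _ a
  · exact map_mul_of_mem_left hx _ a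

/-- The Leibniz rule against the rank one operators `|v⟩⟨e|`, evaluated at a unit vector `e`, reads
`K x v = 𝓛 x v + x K v` with `K v = 𝓛 (|v⟩⟨e|) e`. -/
lemma IsGenerator.exists_eq_commutator (h : T.IsGenerator 𝓛) :
    ∃ K : H →L[ℂ] H, ∀ x ∈ T.decoherenceFree, 𝓛 x = K * x - x * K := by
  rcases subsingleton_or_nontrivial H with hH | hH
  · exact ⟨0, fun x _ => Subsingleton.elim _ _⟩
  obtain ⟨e, he⟩ := exists_norm_eq H zero_le_one
  let K : H →L[ℂ] H := (ContinuousLinearMap.apply ℂ H e) ∘L 𝓛 ∘L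
    (ContinuousLinearMap.apply' (E := H) (F := H →L[ℂ] H) (σ₁₂ := starRingEnd ℂ) e) ∘L
      (InnerProductSpace.rankOne ℂ)
  have hK : ∀ v, K v = 𝓛 (InnerProductSpace.rankOne ℂ v e) e := fun v => rfl
  refine ⟨K, fun x hx => ?_⟩
  ext v
  have h1 := h.apply_mul hx (InnerProductSpace.rankOne ℂ v e)
  have h2 : x * InnerProductSpace.rankOne ℂ v e = InnerProductSpace.rankOne ℂ (x v) e := by
    ext w; simp [InnerProductSpace.rankOne_apply]
  have h3 : InnerProductSpace.rankOne ℂ v e e = v := by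
    rw [InnerProductSpace.rankOne_apply, inner_self_eq_norm_sq_to_K, he]; simp
  have h4 := congrArg (fun f : H →L[ℂ] H => f e) h1
  simp only [h2, add_apply, mul_apply_eq_comp, h3] at h4
  change 𝓛 x v = K (x v) - x (K v)
  rw [hK, hK, h4, add_sub_cancel_right]

/-- Replacing `K` by its skew-adjoint part, which is possible since the generator preserves
adjoints, gives a Hamiltonian. -/
theorem IsGenerator.exists_hamiltonian (h : T.IsGenerator 𝓛) :
    ∃ k : H →L[ℂ] H, IsSelfAdjoint k ∧
      ∀ x ∈ T.decoherenceFree, 𝓛 x = Complex.I • (k * x - x * k) := by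
  obtain ⟨K, hK⟩ := h.exists_eq_commutator
  refine ⟨(-(Complex.I / 2)) • (K - star K), ?_, fun x hx => ?_⟩
  · rw [isSelfAdjoint_iff, star_smul, star_sub, star_star]
    have : star (-(Complex.I / 2)) = Complex.I / 2 := by
      simp [neg_div]
    rw [this, neg_smul, ← smul_neg, neg_sub]
  · have h1 := hK x hx
    have h2 : 𝓛 x = x * star K - star K * x := by
      have := congrArg star (hK _ (T.star_mem_decoherenceFree hx))
      rwa [h.apply_star, star_star, star_sub, star_mul, star_mul, star_star] at this
    have h3 : 𝓛 x = (1 / 2 : ℂ) • (𝓛 x + 𝓛 x) := by module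
    rw [h3]
    nth_rewrite 1 [h1]
    rw [h2, smul_mul_assoc, mul_smul_comm, ← smul_sub, smul_smul]
    have h4 : Complex.I * -(Complex.I / 2) = 1 / 2 := by
      rw [mul_neg, mul_div_assoc', Complex.I_mul_I]; norm_num
    rw [h4]
    congr 1
    noncomm_ring

/-- For a representation in Gorini–Kossakowski–Sudarshan–Lindblad form, the dissipation
`𝓛(x* x) - 𝓛(x*) x - x* 𝓛(x)` is `∑ [Lₗ, x]* [Lₗ, x]`. It vanishes on the
decoherence-free subalgebra by the Leibniz rule. -/
lemma commute_of_gksl (h : T.IsGenerator 𝓛) {k : H →L[ℂ] H} {L : ℕ → H →L[ℂ] H}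
    (hL : ∀ (x : H →L[ℂ] H) (v : H),
      Tendsto (fun n => (Complex.I • (k * x - x * k)) v - (1 / 2 : ℂ) • ∑ l ∈ Finset.range n,
        (star (L l) * L l * x - (2 : ℂ) • (star (L l) * x * L l) + x * (star (L l) * L l)) v)
        atTop (𝓝 (𝓛 x v)))
    {x : H →L[ℂ] H} (hx : x ∈ T.decoherenceFree) (l : ℕ) : L l * x = x * L l := by
  -- the partial sums of the representation, for which the dissipation is computed algebraically
  set D : ℕ → (H →L[ℂ] H) → (H →L[ℂ] H) := fun n y => Complex.I • (k * y - y * k) -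
    (1 / 2 : ℂ) • ∑ l ∈ Finset.range n,
      (star (L l) * L l * y - (2 : ℂ) • (star (L l) * y * L l) + y * (star (L l) * L l)) with hD
  have hDt : ∀ y v, Tendsto (fun n => D n y v) atTop (𝓝 (𝓛 y v)) := fun y v => by
    simpa only [hD, sub_apply, smul_apply, sum_apply] using hL y v
  have hdis : ∀ n, D n (star x * x) - D n (star x) * x - star x * D n x
      = ∑ l ∈ Finset.range n, star (L l * x - x * L l) * (L l * x - x * L l) := by
    intro n
    induction n with
    | zero =>
      simp only [hD, Finset.range_zero, Finset.sum_empty, smul_zero, sub_zero, smul_mul_assoc,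
        mul_smul_comm, ← smul_sub]
      rw [smul_eq_zero]
      right
      noncomm_ring
    | succ n ih =>
      have hs : ∀ y, D (n + 1) y = D n y - (1 / 2 : ℂ) • (star (L n) * L n * y -
          (2 : ℂ) • (star (L n) * y * L n) + y * (star (L n) * L n)) := fun y => by
        simp only [hD, Finset.sum_range_succ, smul_add]
        abel
      rw [Finset.sum_range_succ, ← ih, hs, hs, hs, star_sub, star_mul, star_mul]
      simp only [sub_mul, mul_sub, add_mul, mul_add, smul_mul_assoc, mul_smul_comm, ← mul_assoc]
      module
  ext v
  have hlim : Tendsto (fun n => inner ℂ v ((D n (star x * x) - D n (star x) * x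
      - star x * D n x) v)) atTop (𝓝 0) := by
    have h1 := ((hDt (star x * x) v).sub (hDt (star x) (x v))).sub
      (((star x).continuous.tendsto _).comp (hDt x v))
    have h2 : 𝓛 (star x * x) v - 𝓛 (star x) (x v) - star x (𝓛 x v) = 0 := by
      rw [h.apply_mul (T.star_mem_decoherenceFree hx)]
      simp
    rw [h2] at h1
    have h3 := (tendsto_const_nhds (x := v)).inner (𝕜 := ℂ) h1
    rw [inner_zero_right] at h3
    exact h3
  have hsum : ∀ n, inner ℂ v ((D n (star x * x) - D n (star x) * x - star x * D n x) v)
      = ((∑ l ∈ Finset.range n, ‖(L l * x - x * L l) v‖ ^ 2 : ℝ) : ℂ) := by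
    intro n
    rw [hdis, sum_apply, inner_sum, Complex.ofReal_sum]
    refine Finset.sum_congr rfl fun l _ => ?_
    rw [mul_apply_eq_comp, ContinuousLinearMap.star_eq_adjoint,
      ContinuousLinearMap.adjoint_inner_right, inner_self_eq_norm_sq_to_K]
    simp
  simp only [hsum] at hlim
  have hlim' : Tendsto (fun n => ∑ l ∈ Finset.range n, ‖(L l * x - x * L l) v‖ ^ 2) atTop
      (𝓝 0) := by
    have := (Complex.continuous_re.tendsto 0).comp hlim
    simpa only [Function.comp_def, Complex.ofReal_re, Complex.zero_re] using this
  have hle : ‖(L l * x - x * L l) v‖ ^ 2 ≤ 0 := by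
    refine ge_of_tendsto hlim' ?_
    filter_upwards [eventually_gt_atTop l] with n hn
    exact Finset.single_le_sum (f := fun l => ‖(L l * x - x * L l) v‖ ^ 2)
      (fun _ _ => by positivity) (Finset.mem_range.mpr hn)
  have h0 : (L l * x - x * L l) v = 0 := by
    rw [← norm_eq_zero]
    exact pow_eq_zero_iff two_ne_zero |>.mp (le_antisymm hle (by positivity))
  rwa [sub_apply, sub_eq_zero] at h0

theorem IsGenerator.apply_eq_of_isGKSL (h : T.IsGenerator 𝓛) {k : H →L[ℂ] H}
    {L : ℕ → H →L[ℂ] H} (hkL : T.IsGKSL k L) {x : H →L[ℂ] H} (hx : x ∈ T.decoherenceFree) :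
    𝓛 x = Complex.I • (k * x - x * k) := by
  obtain ⟨-, -, 𝓛', h', hL⟩ := hkL
  obtain rfl := h.unique h'
  have hc : ∀ l, L l * x = x * L l := commute_of_gksl h hL hx
  have hc' : ∀ l, star (L l) * x = x * star (L l) := fun l => by
    have := commute_of_gksl h hL (T.star_mem_decoherenceFree hx) l
    rw [← star_star x, ← star_mul, ← star_mul, this]
  have hterm : ∀ l, star (L l) * L l * x - (2 : ℂ) • (star (L l) * x * L l)
      + x * (star (L l) * L l) = 0 := fun l => by
    rw [mul_assoc, hc l, hc' l, ← mul_assoc, hc' l, mul_assoc]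
    module
  ext v
  refine tendsto_nhds_unique (hL x v) ?_
  simp [hterm]

/-- Where the generator acts as `i [k, ·]`, the group that it generates is the unitary conjugation
`e^{itk} · e^{-itk}`. -/
theorem exp_apply_eq_conj {k z : H →L[ℂ] H}
    (hk : ∀ t : ℝ, 𝓛 (NormedSpace.exp ((t : ℂ) • 𝓛) z) =
      Complex.I • (k * NormedSpace.exp ((t : ℂ) • 𝓛) z - NormedSpace.exp ((t : ℂ) • 𝓛) z * k))
    (t : ℝ) : NormedSpace.exp ((t : ℂ) • 𝓛) z =
      NormedSpace.exp ((t * Complex.I) • k) * z * NormedSpace.exp (-(t * Complex.I) • k) := by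
  set A : H →L[ℂ] H := Complex.I • k with hA
  have e1 : ∀ s : ℝ, ((s : ℂ) * Complex.I) • k = s • A := fun s => by
    rw [mul_smul, hA, Complex.coe_smul]
  have e2 : ∀ s : ℝ, (-((s : ℂ) * Complex.I)) • k = s • (-A) := fun s => by
    rw [neg_smul, e1, smul_neg]
  rw [e1, e2]
  set y : ℝ → (H →L[ℂ] H) := fun s => NormedSpace.exp ((s : ℂ) • 𝓛) z with hy
  have hyd : ∀ s, HasDerivAt y (A * y s - y s * A) s := fun s => by
    have := hasDerivAt_exp_generator 𝓛 z s
    rw [hk s, smul_sub, ← smul_mul_assoc, ← mul_smul_comm] at this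
    exact this
  have hg : ∀ s : ℝ, HasDerivAt
      (fun s : ℝ => NormedSpace.exp (s • (-A)) * y s * NormedSpace.exp (s • A)) 0 s := fun s => by
    have := ((hasDerivAt_exp_smul_const (𝕂 := ℝ) (-A) s).mul (hyd s)).mul
      (hasDerivAt_exp_smul_const' (𝕂 := ℝ) A s)
    refine this.congr_deriv ?_
    rw [Pi.mul_apply]
    generalize NormedSpace.exp (s • (-A)) = E, NormedSpace.exp (s • A) = F
    noncomm_ring
  have hconst := is_const_of_deriv_eq_zero (𝕜 := ℝ) (fun s => (hg s).differentiableAt)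
    (fun s => (hg s).deriv) t 0
  have hy0 : y 0 = z := exp_zero_generator_apply 𝓛 z
  simp only [zero_smul, NormedSpace.exp_zero, one_mul, mul_one, hy0] at hconst
  have hinv := exp_smul_mul_exp_smul_neg A t
  change y t = _
  rw [← hconst]
  calc y t = 1 * y t * 1 := by rw [one_mul, mul_one]
    _ = _ := by
      rw [← hinv]
      simp only [mul_assoc]

end QuantumMarkovSemigroup

/-! ### The group on the decoherence-free subalgebra -/

namespace QuantumMarkovSemigroup

variable {H : Type*} [NormedAddCommGroup H] [InnerProductSpace ℂ H] [CompleteSpace H]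
  {T : QuantumMarkovSemigroup H} {𝓛 : (H →L[ℂ] H) →L[ℂ] (H →L[ℂ] H)}

lemma IsGenerator.mapL_eq (h : T.IsGenerator 𝓛) (t : ℝ) (ht : 0 ≤ t) :
    NormedSpace.exp ((t : ℂ) • 𝓛) = T.mapL ⟨t, ht⟩ :=
  ContinuousLinearMap.ext fun x => (h ⟨t, ht⟩ x).symm

/-- Normality extends to negative times: the bounded maps that preserve the predual form a closed
algebra, which contains the generator. -/
lemma IsGenerator.isNormalMap_exp (h : T.IsGenerator 𝓛) (t : ℝ) :
    IsNormalMap (fun x => NormedSpace.exp ((t : ℂ) • 𝓛) x) := by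
  rw [isNormalMap_iff]
  refine exp_smul_mem_of_forall_nonneg (S := normalMaps H) isClosed_normalMaps (fun s hs => ?_) t
  rw [h.mapL_eq s hs]
  exact (isNormalMap_iff _).mp (T.normal _)

lemma IsGenerator.exp_apply_mem (h : T.IsGenerator 𝓛) (t : ℝ) {z : H →L[ℂ] H}
    (hz : z ∈ T.decoherenceFree) : NormedSpace.exp ((t : ℂ) • 𝓛) z ∈ T.decoherenceFree := by
  refine exp_smul_mem_of_forall_nonneg (S := T.preservingMaps) T.isClosed_preservingMaps
    (fun s hs => ?_) t z hz
  rw [h.mapL_eq s hs]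
  exact fun y hy => T.map_mem_decoherenceFree _ hy

lemma exp_apply_exp_neg_apply (𝓛 : (H →L[ℂ] H) →L[ℂ] (H →L[ℂ] H)) (t : ℝ) (x : H →L[ℂ] H) :
    NormedSpace.exp ((t : ℂ) • 𝓛) (NormedSpace.exp (((-t : ℝ) : ℂ) • 𝓛) x) = x := by
  have h := exp_ofReal_add_smul 𝓛 t (-t)
  rw [add_neg_cancel] at h
  have h2 := congrArg (fun φ : (H →L[ℂ] H) →L[ℂ] (H →L[ℂ] H) => φ x) h
  exact h2.symm.trans (exp_zero_generator_apply 𝓛 x)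

lemma IsGenerator.bijOn (h : T.IsGenerator 𝓛) (t : ℝ) :
    Set.BijOn (fun x => NormedSpace.exp ((t : ℂ) • 𝓛) x) T.decoherenceFree T.decoherenceFree := by
  refine Set.BijOn.mk (fun z hz => h.exp_apply_mem t hz) (fun x _ y _ hxy => ?_) (fun z hz => ?_)
  · have h1 := congrArg (fun y => NormedSpace.exp (((-t : ℝ) : ℂ) • 𝓛) y) hxy
    have h2 := fun x => exp_apply_exp_neg_apply 𝓛 (-t) x
    simp only [neg_neg] at h2
    exact (h2 x).symm.trans (h1.trans (h2 y))
  · exact ⟨_, h.exp_apply_mem (-t) hz, exp_apply_exp_neg_apply 𝓛 t z⟩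

lemma IsGenerator.actsAsStarAutomorphism (h : T.IsGenerator 𝓛) (t : ℝ≥0) :
    ActsAsStarAutomorphism (fun x => T.map t x) T.decoherenceFreeVonNeumannAlgebra := by
  have hbij : Set.BijOn (fun x => T.map t x) T.decoherenceFree T.decoherenceFree := by
    have := h.bijOn t
    simpa only [← h t] using this
  let f : T.decoherenceFreeVonNeumannAlgebra.toStarSubalgebra →⋆ₐ[ℂ]
      T.decoherenceFreeVonNeumannAlgebra.toStarSubalgebra :=
    { toFun := fun x => ⟨T.map t x, T.map_mem_decoherenceFree t x.2⟩
      map_one' := Subtype.ext (T.map_one t)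
      map_mul' := fun x y => Subtype.ext (map_mul_of_mem_left x.2 t y)
      map_zero' := Subtype.ext (_root_.map_zero (T.map t))
      map_add' := fun x y => Subtype.ext (_root_.map_add (T.map t) _ _)
      commutes' := fun r => Subtype.ext (by
        change T.map t (algebraMap ℂ (H →L[ℂ] H) r) = algebraMap ℂ (H →L[ℂ] H) r
        rw [Algebra.algebraMap_eq_smul_one, map_smul, T.map_one])
      map_star' := fun x => Subtype.ext ((T.map t).apply_star x) }
  refine ⟨StarAlgEquiv.ofBijective f ⟨fun x y hxy => ?_, fun z => ?_⟩, fun x => rfl⟩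
  · exact Subtype.ext (hbij.injOn x.2 y.2 (congrArg Subtype.val hxy))
  · obtain ⟨x, hx, hxz⟩ := hbij.surjOn z.2
    exact ⟨⟨x, hx⟩, Subtype.ext hxz⟩

lemma subset_decoherenceFree {M : VonNeumannAlgebra H}
    (hM : ∀ t : ℝ≥0, ActsAsStarAutomorphism (fun x => T.map t x) M) :
    (M : Set (H →L[ℂ] H)) ⊆ T.decoherenceFree := by
  intro x hx t
  obtain ⟨α, hα⟩ := hM t
  let y : M.toStarSubalgebra := ⟨x, hx⟩
  have hy : T.map t x = α y := (hα y).symm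
  have h1 : T.map t (star x * x) = α (star y * y) := (hα (star y * y)).symm
  have h2 : T.map t (x * star x) = α (y * star y) := (hα (y * star y)).symm
  rw [hy, h1, h2, map_mul, map_mul, map_star]
  exact ⟨rfl, rfl⟩

end QuantumMarkovSemigroup

theorem mainTheorem10 {H : Type*} [NormedAddCommGroup H] [InnerProductSpace ℂ H]
    [CompleteSpace H] [TopologicalSpace.SeparableSpace H]
    (T : QuantumMarkovSemigroup H) (hT : T.IsUniformlyContinuous) :
    (∃ N : VonNeumannAlgebra H, (N : Set (H →L[ℂ] H)) = T.decoherenceFree ∧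
      IsGreatest {M : VonNeumannAlgebra H |
        ∀ t : ℝ≥0, ActsAsStarAutomorphism (fun x => T.map t x) M} N) ∧
    ∃ U : ℝ → ((H →L[ℂ] H) →L[ℂ] (H →L[ℂ] H)),
      Continuous U ∧ U 0 = ContinuousLinearMap.id ℂ (H →L[ℂ] H) ∧
      (∀ s t : ℝ, U (s + t) = (U s).comp (U t)) ∧
      (∀ t : ℝ, IsNormalMap (fun x => U t x)) ∧
      (∀ (t : ℝ≥0) (x : H →L[ℂ] H), U t x = T.map t x) ∧
      (∀ t : ℝ, Set.BijOn (fun x => U t x) T.decoherenceFree T.decoherenceFree) ∧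
      (∃ h : H →L[ℂ] H, IsSelfAdjoint h ∧
        ∀ (t : ℝ), ∀ z ∈ T.decoherenceFree,
          U t z = NormedSpace.exp ((t * Complex.I) • h) * z *
            NormedSpace.exp (-(t * Complex.I) • h)) ∧
      (∀ (h : H →L[ℂ] H) (L : ℕ → H →L[ℂ] H), T.IsGKSL h L →
        ∀ (t : ℝ), ∀ z ∈ T.decoherenceFree,
          U t z = NormedSpace.exp ((t * Complex.I) • h) * z *
            NormedSpace.exp (-(t * Complex.I) • h)) := by
  obtain ⟨𝓛, h⟩ := T.exists_isGenerator hT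
  have hconj : ∀ k : H →L[ℂ] H,
      (∀ x ∈ T.decoherenceFree, 𝓛 x = Complex.I • (k * x - x * k)) →
      ∀ (t : ℝ), ∀ z ∈ T.decoherenceFree, NormedSpace.exp ((t : ℂ) • 𝓛) z =
        NormedSpace.exp ((t * Complex.I) • k) * z * NormedSpace.exp (-(t * Complex.I) • k) :=
    fun k hk t z hz => QuantumMarkovSemigroup.exp_apply_eq_conj
      (fun s => hk _ (h.exp_apply_mem s hz)) t
  refine ⟨⟨T.decoherenceFreeVonNeumannAlgebra, rfl, h.actsAsStarAutomorphism,
    fun M hM => QuantumMarkovSemigroup.subset_decoherenceFree hM⟩,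
    fun t => NormedSpace.exp ((t : ℂ) • 𝓛), continuous_exp_ofReal_smul 𝓛,
    exp_ofReal_zero_smul 𝓛,
    fun s t => exp_ofReal_add_smul 𝓛 s t, h.isNormalMap_exp,
    fun t x => (h t x).symm, h.bijOn, ?_, ?_⟩
  · obtain ⟨k, hk, hkz⟩ := h.exists_hamiltonian
    exact ⟨k, hk, hconj k hkz⟩
  · exact fun k L hkL => hconj k fun x hx => h.apply_eq_of_isGKSL hkL hx
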